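/- Let $\Gamma$ be a compact connected (Hausdorff) abelian topological group, written additively, and let $\alpha$ be a topological automorphism of $\Gamma$. Put $$\Omega^{+}=\{g\in\Gamma:\alpha^{n}(g)\to 0 \text{ as } n\to\infty\},\qquad \Omega^{-}=\{g\in\Gamma:\alpha^{n}(g)\to 0 \text{ as } n\to-\infty\},$$ and let $\Omega=\Omega^{+}\cap\Omega^{-}$ be the homoclinic group. Let $G$ be the Pontryagin dual of $\Gamma$, regarded as a module over the ring $\mathbb{Z}[x,x^{-1}]$ of Laurent polynomials, where $x$ acts by the dual automorphism $\chi\mapsto\chi\circ\alpha$. Suppose that $(\Gamma,\alpha)$ is - expansive: there is a neighbourhood $U$ of $0$ in $\Gamma$ with $\bigcap_{n\in\mathbb{Z}}\alpha^{n}(U)=\{0\}$; and - cyclic: $G$ is a cyclic $\mathbb{Z}[x,x^{-1}]$-module. Let $f\in\mathbb{Z}[x]$ be the associated polynomial of $(\Gamma,\alpha)$, that is, the primitive polynomial with $f(0)\neq 0$ and positive leading coefficient which generates the annihilator of $G$ in $\mathbb{Z}[x,x^{-1}]$, and suppose that $f$ is irreducible. Let $\Gamma_0\subset\Gamma$ be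 the path component of the identity $0$. Then the following are equivalent: 1. $\Omega\cap\Gamma_0\neq\{0\}$; 2. $\Omega\subset\Gamma_0$; 3. $f(x)$ or $f(1/x)$ is monic up to a sign, where a Laurent polynomial is called monic up to a sign if the coefficient of its highest power of $x$ is $1$ or $-1$. -/

import Mathlib

open Topology Filter Polynomial LaurentPolynomial

noncomputable section

namespace AlgDyn

section

variable {Γ : Type*} [AddCommGroup Γ] [TopologicalSpace Γ]

/-- The `n`-th iterate `α ^ n`, `n ∈ ℤ`, of a topological automorphism `α` of `Γ`. -/
def iter (α : Γ ≃ₜ+ Γ) (n : ℤ) : Equiv.Perm Γ := (α.toEquiv : Equiv.Perm Γ) ^ n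

/-- The system `(Γ, α)` is expansive: the iterates of some neighbourhood `U` of the identity
have only the identity in common. -/
def IsExpansive (α : Γ ≃ₜ+ Γ) : Prop :=
  ∃ U ∈ 𝓝 (0 : Γ), ⋂ n : ℤ, iter α n '' U = {0}

/-- The stable group `Ω⁺`. -/
def stableGroup (α : Γ ≃ₜ+ Γ) : Set Γ :=
  {g | Tendsto (fun n : ℤ => iter α n g) atTop (𝓝 0)}

/-- The unstable group `Ω⁻`. -/
def unstableGroup (α : Γ ≃ₜ+ Γ) : Set Γ :=
  {g | Tendsto (fun n : ℤ => iter α n g) atBot (𝓝 0)}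

/-- The homoclinic group `Ω = Ω⁺ ∩ Ω⁻`. -/
def homoclinicGroup (α : Γ ≃ₜ+ Γ) : Set Γ := stableGroup α ∩ unstableGroup α

/-- `α` as a continuous homomorphism of `Γ` written multiplicatively (the form in which
`PontryaginDual` takes its argument). -/
def mulHom (α : Γ ≃ₜ+ Γ) : Multiplicative Γ →ₜ* Multiplicative Γ where
  toFun g := Multiplicative.ofAdd (α g.toAdd)
  map_one' := by simp
  map_mul' g h := by simp
  continuous_toFun := continuous_ofAdd.comp (α.continuous.comp continuous_toAdd)

/-- The Pontryagin dual `G` of the phase space `Γ` of the system `(Γ, α)`, written additively. It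
is a type of its own since it carries the `ℤ[x, x⁻¹]`-module structure that depends on `α`. -/
def Dual (_α : Γ ≃ₜ+ Γ) : Type _ := Additive (PontryaginDual (Multiplicative Γ))

instance (α : Γ ≃ₜ+ Γ) : AddCommGroup (Dual α) :=
  inferInstanceAs (AddCommGroup (Additive (PontryaginDual (Multiplicative Γ))))

/-- The value `χ(g)` of a character. -/
def Dual.eval {α : Γ ≃ₜ+ Γ} (χ : Dual α) (g : Γ) : Circle :=
  (Additive.toMul χ : PontryaginDual (Multiplicative Γ)) (Multiplicative.ofAdd g)

/-- Precomposition `χ ↦ χ ∘ β` of characters with a topological automorphism `β`. -/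
def precomp (α β : Γ ≃ₜ+ Γ) : AddMonoid.End (Dual α) :=
  MonoidHom.toAdditive (PontryaginDual.map (mulHom β)).toMonoidHom

theorem Dual.ext {α : Γ ≃ₜ+ Γ} {χ ψ : Dual α} (h : ∀ g, χ.eval g = ψ.eval g) : χ = ψ :=
  Additive.toMul.injective (PontryaginDual.ext fun g => h g.toAdd)

theorem precomp_eval (α β : Γ ≃ₜ+ Γ) (χ : Dual α) (g : Γ) :
    (precomp α β χ).eval g = χ.eval (β g) := rfl

/-- The dual automorphism `χ ↦ χ ∘ α` of `G`. -/
def dualUnit (α : Γ ≃ₜ+ Γ) : (AddMonoid.End (Dual α))ˣ where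
  val := precomp α α
  inv := precomp α α.symm
  val_inv := by
    ext χ
    refine Dual.ext fun g => ?_
    change χ.eval (α.symm (α g)) = χ.eval g
    simp
  inv_val := by
    ext χ
    refine Dual.ext fun g => ?_
    change χ.eval (α (α.symm g)) = χ.eval g
    simp

/-- The ring homomorphism `ℤ[x, x⁻¹] → End G` which sends `x` to the dual automorphism. -/
def dualRep (α : Γ ≃ₜ+ Γ) : ℤ[T;T⁻¹] →+* AddMonoid.End (Dual α) :=
  (AddMonoidAlgebra.lift ℤ (AddMonoid.End (Dual α)) ℤ
    ((Units.coeHom (AddMonoid.End (Dual α))).comp (zpowersHom _ (dualUnit α)))).toRingHom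

/-- The dual group `G` as a module over the ring `ℤ[x, x⁻¹]` of Laurent polynomials; `x` acts by
the dual automorphism `χ ↦ χ ∘ α`. -/
instance (α : Γ ≃ₜ+ Γ) : Module ℤ[T;T⁻¹] (Dual α) := Module.compHom (Dual α) (dualRep α)

theorem T_smul_eval (α : Γ ≃ₜ+ Γ) (n : ℤ) (χ : Dual α) (g : Γ) :
    ((T n : ℤ[T;T⁻¹]) • χ).eval g = χ.eval (iter α n g) := by
  have key : ((T n : ℤ[T;T⁻¹]) • χ) = ((dualUnit α ^ n : (AddMonoid.End (Dual α))ˣ) :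
      AddMonoid.End (Dual α)) χ := by
    change (AddMonoidAlgebra.lift ℤ (AddMonoid.End (Dual α)) ℤ
      ((Units.coeHom (AddMonoid.End (Dual α))).comp (zpowersHom _ (dualUnit α))))
      (.single n 1) χ = _
    rw [AddMonoidAlgebra.lift_single, one_smul]
    rfl
  rw [key]
  clear key
  induction n using Int.induction_on generalizing χ g with
  | zero => rw [iter, zpow_zero, zpow_zero]; rfl
  | succ n ih =>
    rw [zpow_add, zpow_one, Units.val_mul, AddMonoid.End.coe_mul, Function.comp_apply, ih]
    change χ.eval (α (iter α n g)) = _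
    rw [iter, iter, add_comm, zpow_add, zpow_one]
    rfl
  | pred n ih =>
    rw [zpow_sub, ← zpow_neg_one, Units.val_mul, AddMonoid.End.coe_mul, Function.comp_apply, ih,
      zpow_neg_one]
    change χ.eval (α.symm (iter α (-n) g)) = _
    rw [iter, iter, sub_eq_neg_add, zpow_add, zpow_neg_one]
    rfl

/-- The system `(Γ, α)` is cyclic: the dual group is a cyclic `ℤ[x, x⁻¹]`-module. -/
def IsCyclicSystem (α : Γ ≃ₜ+ Γ) : Prop :=
  (⊤ : Submodule ℤ[T;T⁻¹] (Dual α)).IsPrincipal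

/-- `f` is the associated polynomial of the system `(Γ, α)`: it is a primitive polynomial with
`f(0) ≠ 0` and positive leading coefficient which generates the annihilator of the dual group. -/
structure IsAssociatedPolynomial (α : Γ ≃ₜ+ Γ) (f : ℤ[X]) : Prop where
  isPrimitive : f.IsPrimitive
  coeff_zero_ne_zero : f.coeff 0 ≠ 0
  leadingCoeff_pos : 0 < f.leadingCoeff
  annihilator_eq : Module.annihilator ℤ[T;T⁻¹] (Dual α) = Ideal.span {toLaurent f}

end

/-- A Laurent polynomial is monic up to a sign: the coefficient of the highest power of `x` is
`1` or `-1`. -/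
def IsMonicUpToSign (p : ℤ[T;T⁻¹]) : Prop :=
  ∃ n : ℤ, (p.coeff n = 1 ∨ p.coeff n = -1) ∧ ∀ m, n < m → p.coeff m = 0

end AlgDyn

end

/-!
Let `χ` generate the dual group. The itinerary map `g ↦ (χ(αⁿ g))ₙ` identifies `Γ` with the group
of all `z : ℤ → ℝ / ℤ` that satisfy the linear recurrence `f(S) z = 0`, where `S` is the shift, and
`α` with `S`. It is injective because the characters of a compact abelian group separate points
(`exists_character_ne_one`), and its range is everything by a Fourier argument
(`AlgDyn.exists_code_eq`). Separation of points is obtained from the Gelfand transform of the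
commutative C*-algebra of operators on `L²` generated by translations and convolutions.

In this model everything is expressed by real lifts of `z`.

* `g` is homoclinic iff `z` tends to `0` at both ends. A lift `x` of `z` that tends to `0` has
  integer-valued `f(S) x`, which tends to `0` and so has finite support.
* `g` lies in the path component of `0` iff `z` has a lift `u` with `f(S) u = 0`: a path is lifted
  coordinatewise, and conversely `t ↦ t u mod 1` is a path.
* Expansiveness says that a bounded real solution of `f(S) u = 0` is zero. In particular `f` has
  no root on the unit circle.

So a homoclinic point lies in the path component of `0` iff `f(S) v = f(S) x` has an *integer*
solution `v`, namely `v = x - u`. If the leading or the constant coefficient of `f` is `±1`, such a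
`v` is computed term by term, in one direction or the other. If neither is, then `v` has finite
support by a form of Fatou's lemma (`isUnit_leadingCoeff_of_recurrence`): the integer sequences on a
half-line killed by `f(S)` form a finitely generated group, where `S` satisfies a monic integer
equation, which `f` divides unless there are no such sequences. Then `u` tends to `0` along with
`x`, so `u = 0` and `z = 0`.

There are nonzero homoclinic points: since `f` has no root on the unit circle, the Fourier
coefficients of `1 / f` give a real `y` tending to `0` with `f(S) y = δ`; the values of `y` are not
all integers, since otherwise `y` would have finite support and `f(S) y` two nonzero terms.
-/

/-! ### Characters of compact abelian groups -/

section Gelfand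

open WeakDual in
/-- The Gelfand transform of a commutative C*-algebra is injective, so a commuting family of
operators generates an algebra whose characters separate its points. -/
theorem exists_starAlgHom_apply_ne {A : Type*} [CStarAlgebra A] (S : Set A)
    (hcomm : ∀ a ∈ S, ∀ b ∈ S, a * b = b * a)
    (hstar : ∀ a ∈ S, ∀ b ∈ S, a * star b = star b * a) :
    ∃ B : StarSubalgebra ℂ A, S ⊆ B ∧ ∀ a b : B, a ≠ b →
      ∃ ω : B →⋆ₐ[ℂ] ℂ, Continuous ω ∧ ω a ≠ ω b := by
  let B := (StarAlgebra.adjoin ℂ S).topologicalClosure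
  have hc := StarAlgebra.isMulCommutative_adjoin ℂ hcomm hstar
  let : CStarAlgebra B := StarSubalgebra.cstarAlgebra B
    (h_closed := StarSubalgebra.isClosed_topologicalClosure _)
  let : CommCStarAlgebra B :=
    { (inferInstance : CStarAlgebra B) with
      mul_comm := (StarSubalgebra.commRingTopologicalClosure (StarAlgebra.adjoin ℂ S)
        fun x y => mul_comm' x y).mul_comm }
  refine ⟨B, (StarAlgebra.subset_adjoin ℂ S).trans (StarSubalgebra.le_topologicalClosure _),
    fun a b hab => ?_⟩
  have hinj := (gelfandTransform_isometry B).injective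
  have : gelfandTransform ℂ B a ≠ gelfandTransform ℂ B b := fun h => hab (hinj h)
  rw [Ne, ContinuousMap.ext_iff, not_forall] at this
  obtain ⟨ω, hω⟩ := this
  exact ⟨{ CharacterSpace.toAlgHom ω with map_star' := fun x => map_star ω x},
    map_continuous ω, hω⟩

end Gelfand

section Representation

open MeasureTheory ContinuousLinearMap

variable {G E : Type*} [CommGroup G] [NormedAddCommGroup E] [InnerProductSpace ℂ E]
  {U : G →* (E →L[ℂ] E)}

theorem rep_mul_comm (g h : G) : U g * U h = U h * U g := by
  rw [← map_mul, mul_comm, map_mul]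

theorem star_rep [CompleteSpace E] (hiso : ∀ g φ, ‖U g φ‖ = ‖φ‖) (g : G) :
    star (U g) = U g⁻¹ := by
  have h1 : star (U g) * U g = 1 := (norm_map_iff_adjoint_comp_self (U g)).1 (hiso g)
  have h2 : U g * U g⁻¹ = 1 := by rw [← map_mul, mul_inv_cancel, map_one]
  exact left_inv_eq_right_inv h1 h2

variable [TopologicalSpace G] [CompactSpace G] [MeasurableSpace G] (μ : Measure G)
  [IsProbabilityMeasure μ]

theorem integrable_smul_rep [BorelSpace G] (hU : ∀ φ, Continuous fun g => U g φ) (k : C(G, ℂ))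
    (φ : E) :
    Integrable (fun g => k g • U g φ) μ :=
  (k.continuous.smul (hU φ)).integrable_of_hasCompactSupport (.of_compactSpace _)

theorem norm_integral_smul_rep_le (hiso : ∀ g φ, ‖U g φ‖ = ‖φ‖) (k : C(G, ℂ)) (φ : E) :
    ‖∫ g, k g • U g φ ∂μ‖ ≤ ‖k‖ * ‖φ‖ := by
  have := norm_integral_le_of_norm_le_const (μ := μ) (f := fun g => k g • U g φ) (C := ‖k‖ * ‖φ‖)
    (.of_forall fun g => by
      rw [norm_smul, hiso]
      gcongr
      exact k.norm_coe_le_norm g)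
  simpa using this

variable [BorelSpace G]

/-- The operator `φ ↦ ∫ k(g) U(g) φ dg` attached to a continuous function `k` on the group and a
strongly continuous isometric representation `U`. -/
noncomputable def averagedOperator (hU : ∀ φ, Continuous fun g => U g φ)
    (hiso : ∀ g φ, ‖U g φ‖ = ‖φ‖) (k : C(G, ℂ)) : E →L[ℂ] E :=
  LinearMap.mkContinuous
    { toFun := fun φ => ∫ g, k g • U g φ ∂μ
      map_add' := fun φ ψ => by
        rw [← integral_add (integrable_smul_rep μ hU k φ) (integrable_smul_rep μ hU k ψ)]
        simp
      map_smul' := fun c φ => by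
        rw [RingHom.id_apply, ← integral_smul]
        simp [smul_comm c] }
    ‖k‖ fun φ => norm_integral_smul_rep_le μ hiso k φ

variable (hU : ∀ φ, Continuous fun g => U g φ) (hiso : ∀ g φ, ‖U g φ‖ = ‖φ‖)

theorem averagedOperator_apply (k : C(G, ℂ)) (φ : E) :
    averagedOperator μ hU hiso k φ = ∫ g, k g • U g φ ∂μ := rfl

theorem norm_averagedOperator_le (k : C(G, ℂ)) : ‖averagedOperator μ hU hiso k‖ ≤ ‖k‖ :=
  LinearMap.mkContinuous_norm_le _ (norm_nonneg _) _

theorem averagedOperator_sub (k l : C(G, ℂ)) :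
    averagedOperator μ hU hiso (k - l)
      = averagedOperator μ hU hiso k - averagedOperator μ hU hiso l := by
  ext φ
  simp only [averagedOperator_apply, sub_apply]
  rw [← integral_sub (integrable_smul_rep μ hU k φ) (integrable_smul_rep μ hU l φ)]
  simp [sub_smul]

variable [CompleteSpace E]

/-- An operator commuting with the representation commutes with the averaged operators. -/
theorem commute_averagedOperator (k : C(G, ℂ)) {V : E →L[ℂ] E} (hV : ∀ g, V * U g = U g * V) :
    V * averagedOperator μ hU hiso k = averagedOperator μ hU hiso k * V := by
  ext φ
  simp only [mul_apply_eq_comp, averagedOperator_apply]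
  rw [← V.integral_comp_comm (integrable_smul_rep μ hU k φ)]
  refine integral_congr_ae (.of_forall fun g => ?_)
  have := congr($(hV g) φ)
  simp only [mul_apply_eq_comp] at this
  simp [this]

theorem rep_mul_averagedOperator [IsTopologicalGroup G] [μ.IsMulLeftInvariant] (h : G)
    (k : C(G, ℂ)) :
    U h * averagedOperator μ hU hiso k =
      averagedOperator μ hU hiso (k.comp (ContinuousMap.mulLeft h⁻¹)) := by
  ext φ
  simp only [mul_apply_eq_comp, averagedOperator_apply]
  rw [← (U h).integral_comp_comm (integrable_smul_rep μ hU k φ),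
    ← integral_mul_left_eq_self (fun g => k.comp (ContinuousMap.mulLeft h⁻¹) g • U g φ) h]
  refine integral_congr_ae (.of_forall fun g => ?_)
  simp

theorem continuous_rep_mul_averagedOperator [IsTopologicalGroup G] [μ.IsMulLeftInvariant]
    (k : C(G, ℂ)) :
    Continuous fun h => U h * averagedOperator μ hU hiso k := by
  have h1 : Continuous fun h : G => k.comp (ContinuousMap.mulLeft h⁻¹) := by
    let F : C(G × G, ℂ) := ⟨fun p => k (p.1⁻¹ * p.2), by fun_prop⟩
    exact F.curry.continuous
  have h2 : LipschitzWith 1 (averagedOperator μ hU hiso) :=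
    LipschitzWith.of_dist_le_mul fun k l => by
      rw [dist_eq_norm, dist_eq_norm, ← averagedOperator_sub, NNReal.coe_one, one_mul]
      exact norm_averagedOperator_le ..
  simp_rw [rep_mul_averagedOperator]
  exact h2.continuous.comp h1

include hU hiso in
/-- A vector `ψ` in the range of `U g₀ - 1` pairs with `T_k ψ`, where `k` is the conjugate of the
matrix coefficient of `ψ`, to the integral of `|⟪ψ, U g ψ⟫|²`. -/
theorem exists_rep_mul_averagedOperator_ne [μ.IsOpenPosMeasure] [μ.IsMulLeftInvariant] {g₀ : G}
    (hg₀ : U g₀ ≠ 1) :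
    ∃ k, U g₀ * averagedOperator μ hU hiso k ≠ averagedOperator μ hU hiso k := by
  by_contra! H
  apply hg₀
  ext φ
  by_contra hφ
  set ψ := U g₀ φ - φ with hψ
  have hψ0 : ψ ≠ 0 := sub_ne_zero.2 hφ
  let F : C(G, ℂ) := ⟨fun g => inner ℂ ψ (U g ψ), continuous_const.inner (hU ψ)⟩
  let k : C(G, ℂ) := star F
  have h0 : averagedOperator μ hU hiso k ψ = 0 := by
    have hc := commute_averagedOperator μ hU hiso k (V := U g₀) fun g => rep_mul_comm _ _
    have := congr($(hc.symm.trans (H k)) φ)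
    simp only [mul_apply_eq_comp] at this
    rw [hψ, map_sub, this, sub_self]
  have h1 : ∫ g, (‖F g‖ ^ 2 : ℝ) ∂μ = 0 := by
    have h2 : inner ℂ ψ (averagedOperator μ hU hiso k ψ) = 0 := by rw [h0, inner_zero_right]
    rw [averagedOperator_apply, ← integral_inner (integrable_smul_rep μ hU k ψ)] at h2
    have h3 : ∀ g, inner ℂ ψ (k g • U g ψ) = ((‖F g‖ ^ 2 : ℝ) : ℂ) := fun g => by
      rw [inner_smul_right]
      change star (F g) * F g = _
      rw [Complex.star_def, ← Complex.normSq_eq_conj_mul_self, Complex.normSq_eq_norm_sq]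
    simp_rw [h3] at h2
    rw [integral_complex_ofReal] at h2
    exact_mod_cast h2
  have hcont : Continuous fun g => (‖F g‖ ^ 2 : ℝ) := by fun_prop
  rw [integral_eq_zero_iff_of_nonneg (fun _ => by positivity)
    (hcont.integrable_of_hasCompactSupport (.of_compactSpace _))] at h1
  have h4 := congr_fun (Continuous.ae_eq_iff_eq μ hcont continuous_const |>.1 h1) 1
  have : F 1 = 0 := by
    have h5 : ‖F 1‖ ^ 2 = 0 := h4
    simpa using h5
  apply hψ0
  change inner ℂ ψ (U 1 ψ) = 0 at this
  simpa using this

include hU hiso in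
/-- A continuous character of the group is found by evaluating a character of the commutative
C*-algebra generated by the `U g` and the averaged operators; it is continuous because
`g ↦ U g * T_k` is continuous in norm. -/
theorem exists_character_of_rep [IsTopologicalGroup G] [μ.IsOpenPosMeasure]
    [μ.IsMulLeftInvariant] {g₀ : G} (hg₀ : U g₀ ≠ 1) : ∃ χ : G →ₜ* Circle, χ g₀ ≠ 1 := by
  -- A character `ω` of the algebra separating `U g₀ * T_k` from `T_k` has `ω (U g₀) ≠ 1` and
  -- `ω T_k ≠ 0`, so `ω (U g)` is the quotient of `ω (U g * T_k)` by a nonzero constant.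
  obtain ⟨k, hk⟩ := exists_rep_mul_averagedOperator_ne μ hU hiso hg₀
  set T := averagedOperator μ hU hiso k with hT
  have hTU : ∀ g, T * U g = U g * T := fun g =>
    (commute_averagedOperator μ hU hiso k fun h => rep_mul_comm g h).symm
  have hTU' : ∀ g, star T * U g = U g * star T := fun g => by
    have := congr(star $(hTU g⁻¹))
    rw [star_mul, star_mul, star_rep hiso, inv_inv] at this
    exact this.symm
  obtain ⟨B, hB, hsep⟩ := exists_starAlgHom_apply_ne (insert T (Set.range U))
    (by
      rintro a (rfl | ⟨g, rfl⟩) b (rfl | ⟨h, rfl⟩)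
      · rfl
      · exact hTU h
      · exact (hTU g).symm
      · exact rep_mul_comm g h)
    (by
      rintro a (rfl | ⟨g, rfl⟩) b (rfl | ⟨h, rfl⟩)
      · exact (commute_averagedOperator μ hU hiso k hTU').symm
      · rw [star_rep hiso]; exact hTU _
      · exact (hTU' g).symm
      · rw [star_rep hiso]; exact rep_mul_comm _ _)
  let u : G →* B :=
    { toFun := fun g => ⟨U g, hB (Or.inr ⟨g, rfl⟩)⟩
      map_one' := Subtype.ext (map_one U)
      map_mul' := fun g h => Subtype.ext (map_mul U g h) }
  let t : B := ⟨T, hB (Or.inl rfl)⟩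
  obtain ⟨ω, hω, hne⟩ := hsep (u g₀ * t) t fun h => hk (congr_arg Subtype.val h)
  rw [map_mul] at hne
  have ht : ω t ≠ 0 := fun h => hne (by rw [h, mul_zero])
  have hcont : Continuous fun g => ω (u g) := by
    have h1 : Continuous fun g => ω (u g * t) :=
      hω.comp ((continuous_rep_mul_averagedOperator μ hU hiso k).subtype_mk _)
    simp_rw [map_mul] at h1
    simpa [ht] using h1.div_const (ω t)
  have hnorm : ∀ g, ‖ω (u g)‖ = 1 := fun g => by
    have h1 : star (u g) * u g = 1 := Subtype.ext <| by
      change star (U g) * U g = 1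
      rw [star_rep hiso, ← map_mul, inv_mul_cancel, map_one]
    have h2 := congr(ω $h1)
    rw [map_mul, map_star, map_one, Complex.star_def, ← Complex.normSq_eq_conj_mul_self,
      Complex.normSq_eq_norm_sq] at h2
    have h3 : ‖ω (u g)‖ ^ 2 = 1 := by exact_mod_cast h2
    exact (pow_eq_one_iff_of_nonneg (norm_nonneg _) two_ne_zero).1 h3
  refine ⟨⟨⟨⟨fun g => ⟨ω (u g), by
    simpa [Submonoid.unitSphere] using hnorm g⟩, ?_⟩, ?_⟩, ?_⟩, ?_⟩
  · exact Circle.ext (by simp)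
  · exact fun g h => Circle.ext ((congr_arg ω (map_mul u g h)).trans (map_mul ω _ _))
  · exact Continuous.subtype_mk hcont _
  · intro h
    have : ω (u g₀) = 1 := congr_arg ((↑) : Circle → ℂ) h
    exact hne (by rw [this, one_mul])

end Representation

open MeasureTheory DomMulAct in
/-- The characters of a compact abelian group separate its points: the translations on
`L²` form a faithful representation. -/
theorem exists_character_ne_one {G : Type*} [CommGroup G] [TopologicalSpace G]
    [IsTopologicalGroup G] [CompactSpace G] [T2Space G] {g : G} (hg : g ≠ 1) :
    ∃ χ : G →ₜ* Circle, χ g ≠ 1 := by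
  borelize G
  obtain ⟨μ, _, _, _⟩ : ∃ μ : Measure G, IsProbabilityMeasure μ ∧ μ.IsHaarMeasure ∧ μ.Regular :=
    ⟨Measure.haarMeasure ⊤, ⟨Measure.haarMeasure_self (K₀ := ⊤)⟩, inferInstance, inferInstance⟩
  have : Fact ((2 : ENNReal) ≠ ⊤) := ⟨ENNReal.ofNat_ne_top⟩
  let U : G →* (Lp ℂ 2 μ →L[ℂ] Lp ℂ 2 μ) :=
    { toFun := fun g => LinearMap.mkContinuous
        { toFun := fun φ => mk g • φ
          map_add' := fun φ ψ => smul_add _ _ _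
          map_smul' := fun c φ => smul_comm _ _ _ } 1 fun φ => by simp [norm_smul_Lp]
      map_one' := by
        ext1 φ
        exact one_smul Gᵈᵐᵃ φ
      map_mul' := fun g h => by
        ext1 φ
        change mk (g * h) • φ = mk g • mk h • φ
        rw [mul_comm, mk_mul, mul_smul] }
  have hU : ∀ φ, Continuous fun g => U g φ := fun φ => by
    have : Continuous fun c : Gᵈᵐᵃ => c • φ := continuous_id.smul continuous_const
    exact this.comp mkHomeomorph.continuous
  refine exists_character_of_rep μ hU (fun g φ => norm_smul_Lp _ _) (g₀ := g) fun h => hg ?_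
  by_contra hne
  obtain ⟨F, hF0, hF1, -⟩ := exists_continuous_zero_one_of_isClosed
    (isClosed_singleton (x := (1 : G))) (isClosed_singleton (x := g)) (by simpa using Ne.symm hne)
  let F' : G → ℂ := fun x => F x
  have hF' : Continuous F' := by fun_prop
  have hm : MemLp F' 2 μ :=
    (hF'.memLp_of_hasCompactSupport (.of_compactSpace _))
  have h1 : mk g • hm.toLp F' = hm.toLp F' := congr($h (hm.toLp F'))
  rw [mk_smul_toLp, MemLp.toLp_eq_toLp_iff] at h1
  have h2 := congr_fun ((Continuous.ae_eq_iff_eq μ (by fun_prop) hF').1 h1) 1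
  have h3 : F g = 0 := by
    have : F (g • 1) = F 1 := by simpa [F'] using h2
    rw [smul_eq_mul, mul_one] at this
    rw [this]
    exact hF0 rfl
  exact zero_ne_one (h3.symm.trans (hF1 rfl))

/-! ### Linear recurrences -/

section Recurrence

variable {ι κ A B : Type*} [AddCommGroup A] [AddCommGroup B]

/-- The operator `f(S)` on families `u : ι → A`, where `f` is an integer polynomial and `S` is the
substitution `u ↦ u ∘ s`. For the translation `s` of `ℤ` or `ℕ` by `1` the equation `f(S) u = 0` is
the linear recurrence with characteristic polynomial `f`. -/
noncomputable def recurrence (s : ι → ι) (f : ℤ[X]) (u : ι → A) : ι → A :=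
  aeval (LinearMap.funLeft ℤ A s : Module.End ℤ (ι → A)) f u

theorem funLeft_pow_apply (s : ι → ι) (k : ℕ) (u : ι → A) (n : ι) :
    ((LinearMap.funLeft ℤ A s : Module.End ℤ (ι → A)) ^ k) u n = u (s^[k] n) := by
  induction k generalizing n with
  | zero => rfl
  | succ k ih => rw [pow_succ', Module.End.mul_apply, LinearMap.funLeft_apply, ih]; rfl

theorem recurrence_apply (s : ι → ι) (f : ℤ[X]) (u : ι → A) (n : ι) :
    recurrence s f u n = ∑ i ∈ Finset.range (f.natDegree + 1), f.coeff i • u (s^[i] n) := by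
  rw [recurrence, aeval_eq_sum_range, LinearMap.sum_apply, Finset.sum_apply]
  refine Finset.sum_congr rfl fun i _ => ?_
  rw [LinearMap.smul_apply, Pi.smul_apply, funLeft_pow_apply]

theorem recurrence_map (φ : A →+ B) (s : ι → ι) (f : ℤ[X]) (u : ι → A) :
    recurrence s f (φ ∘ u) = φ ∘ recurrence s f u := by
  ext n
  simp [recurrence_apply]

theorem recurrence_comp {s : ι → ι} {t : κ → κ} {e : κ → ι} (h : Function.Semiconj e t s)
    (f : ℤ[X]) (u : ι → A) : recurrence t f (u ∘ e) = recurrence s f u ∘ e := by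
  ext n
  simp [recurrence_apply, (h.iterate_right _).eq]

theorem add_one_iterate_int (i : ℕ) (n : ℤ) : (· + 1)^[i] n = n + i := by simp

theorem sub_one_iterate_int (i : ℕ) (n : ℤ) : (· - 1)^[i] n = n - i := by
  induction i generalizing n with
  | zero => simp
  | succ i ih => rw [Function.iterate_succ_apply, ih]; push_cast; ring

theorem recurrence_int_apply (f : ℤ[X]) (u : ℤ → A) (n : ℤ) :
    recurrence (· + 1) f u n = ∑ i ∈ Finset.range (f.natDegree + 1), f.coeff i • u (n + i) := by
  simp only [recurrence_apply, add_one_iterate_int]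

theorem recurrence_reverse {f : ℤ[X]} (hf : f.coeff 0 ≠ 0) (u : ℤ → A) (n : ℤ) :
    recurrence (· - 1) f.reverse u (n + f.natDegree) = recurrence (· + 1) f u n := by
  have hd : f.reverse.natDegree = f.natDegree := by
    rw [reverse_natDegree, natTrailingDegree_eq_zero.2 (Or.inr hf), Nat.sub_zero]
  rw [recurrence_apply, recurrence_int_apply, hd, ← Finset.sum_range_reflect]
  refine Finset.sum_congr rfl fun i hi => ?_
  have hi' : i ≤ f.natDegree := Nat.lt_succ_iff.1 (Finset.mem_range.1 hi)
  rw [sub_one_iterate_int, coeff_reverse, Nat.add_sub_cancel,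
    revAt_le (Nat.sub_le _ _), Nat.sub_sub_self hi', Nat.cast_sub hi']
  congr 2
  ring

theorem irreducible_reverse {f : ℤ[X]} (hf : Irreducible f) (h0 : f.coeff 0 ≠ 0) :
    Irreducible f.reverse := by
  have hrr : f.reverse.reverse = f := by
    have hd : f.reverse.natDegree = f.natDegree := by
      rw [reverse_natDegree, natTrailingDegree_eq_zero.2 (Or.inr h0), Nat.sub_zero]
    ext i
    rw [coeff_reverse, coeff_reverse, hd, revAt_invol]
  have key : ∀ a : ℤ[X], a.coeff 0 ≠ 0 → IsUnit a.reverse → IsUnit a := fun a ha hu => by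
    have hd : a.natDegree = 0 := by
      have := natDegree_eq_zero_of_isUnit hu
      rwa [reverse_natDegree, natTrailingDegree_eq_zero.2 (Or.inr ha), Nat.sub_zero] at this
    rw [eq_C_of_natDegree_eq_zero hd] at hu ⊢
    rwa [reverse_C] at hu
  refine ⟨fun hu => hf.not_isUnit ?_, fun a b hab => ?_⟩
  · refine key f h0 hu
  · have hc : a.coeff 0 * b.coeff 0 ≠ 0 := by
      rw [← mul_coeff_zero, ← hab, coeff_zero_reverse]
      exact leadingCoeff_ne_zero.2 hf.ne_zero
    have := hf.isUnit_or_isUnit (a := a.reverse) (b := b.reverse)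
      (by rw [← reverse_mul_of_domain, ← hab, hrr])
    exact this.imp (key a (left_ne_zero_of_mul hc)) (key b (right_ne_zero_of_mul hc))

end Recurrence

/-! ### Fatou's lemma -/

section Fatou

theorem natDegree_ne_zero_of_isPrimitive {f : ℤ[X]} (hf : Irreducible f) (hp : f.IsPrimitive) :
    f.natDegree ≠ 0 := fun h => hf.not_isUnit <| by
  rw [eq_C_of_natDegree_eq_zero h] at hp ⊢
  exact (hp _ dvd_rfl).map Polynomial.C

/-- An integer solution of a recurrence of order `d` is determined by its first `d` terms. -/
theorem eq_zero_of_recurrence_eq_zero {f : ℤ[X]} (hf : f ≠ 0) {v : ℕ → ℤ}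
    (hv : recurrence Nat.succ f v = 0) (h0 : ∀ i < f.natDegree, v i = 0) : v = 0 := by
  ext n
  induction n using Nat.strong_induction_on with
  | _ n ih =>
  by_cases hn : n < f.natDegree
  · exact h0 n hn
  · have h1 := congr_fun hv (n - f.natDegree)
    rw [recurrence_apply, Finset.sum_range_succ, Finset.sum_eq_zero, zero_add] at h1
    · rw [Nat.succ_iterate, Nat.sub_add_cancel (not_lt.1 hn)] at h1
      simpa [hf] using h1
    · intro i hi
      rw [Nat.succ_iterate, ih _ (by have := Finset.mem_range.1 hi; omega)]
      simp

/-- If `f` and `p` are coprime over `ℚ`, then a nonzero integer lies in the ideal `(f, p)`, so the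
two recurrences have no common nonzero torsion-free solution. -/
theorem dvd_of_recurrence_eq_zero {f p : ℤ[X]} (hf : Irreducible f) (hprim : f.IsPrimitive)
    {v : ℕ → ℤ} (hv : v ≠ 0) (h1 : recurrence Nat.succ f v = 0)
    (h2 : recurrence Nat.succ p v = 0) : f ∣ p := by
  by_contra hdvd
  have hcop : IsCoprime (f.map (Int.castRingHom ℚ)) (p.map (Int.castRingHom ℚ)) := by
    rw [((IsPrimitive.Int.irreducible_iff_irreducible_map_cast hprim).1 hf).coprime_iff_not_dvd]
    rintro ⟨q, hq⟩
    exact hdvd (IsPrimitive.dvd_of_fraction_map_dvd_fraction_map (K := ℚ) hprim ⟨q, hq⟩)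
  have hd := natDegree_ne_zero_of_isPrimitive hf hprim
  obtain ⟨a, b, -, -, hab⟩ := exists_mul_add_mul_eq_C_resultant f p le_rfl le_rfl (Or.inl hd)
  have hr : resultant f p ≠ 0 := fun h => by
    have := resultant_ne_zero _ _ hcop
    rw [natDegree_map_eq_of_injective (RingHom.injective_int _),
      natDegree_map_eq_of_injective (RingHom.injective_int _), resultant_map_map, h] at this
    exact this (map_zero _)
  have h3 := congr(recurrence Nat.succ $hab v)
  rw [recurrence] at h1 h2 h3
  rw [map_add, mul_comm f, mul_comm p, map_mul, map_mul, LinearMap.add_apply,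
    Module.End.mul_apply, Module.End.mul_apply, h1, h2, map_zero, map_zero, add_zero, recurrence,
    aeval_C] at h3
  apply hv
  ext n
  have h4 := congr_fun h3 n
  simpa [hr, Algebra.algebraMap_eq_smul_one] using h4.symm

/-- A form of Fatou's lemma: if a nonzero integer sequence satisfies the recurrence given by an
irreducible primitive polynomial `f`, then the leading coefficient of `f` is a unit. The solutions
form a finitely generated abelian group, on which the shift satisfies a monic equation. -/
theorem isUnit_leadingCoeff_of_recurrence {f : ℤ[X]} (hf : Irreducible f) (hprim : f.IsPrimitive)
    {v : ℕ → ℤ} (hv : v ≠ 0) (h1 : recurrence Nat.succ f v = 0) : IsUnit f.leadingCoeff := by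
  let M := LinearMap.ker (aeval (LinearMap.funLeft ℤ ℤ Nat.succ : Module.End ℤ (ℕ → ℤ)) f)
  let S : Module.End ℤ (ℕ → ℤ) := LinearMap.funLeft ℤ ℤ Nat.succ
  have hS : ∀ u ∈ M, S u ∈ M := fun u hu => by
    have := recurrence_comp (s := Nat.succ) (t := Nat.succ) (e := Nat.succ) (fun _ => rfl) f u
    rw [show recurrence Nat.succ f u = 0 from hu] at this
    exact this
  let E : M →ₗ[ℤ] (Fin f.natDegree → ℤ) :=
    (LinearMap.funLeft ℤ ℤ (Fin.val : Fin f.natDegree → ℕ)).comp M.subtype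
  have hfin : Module.Finite ℤ M := Module.Finite.of_injective E <| by
    rw [injective_iff_map_eq_zero]
    exact fun u hu => Subtype.ext (eq_zero_of_recurrence_eq_zero hf.ne_zero u.2
      fun i hi => congr_fun hu ⟨i, hi⟩)
  obtain ⟨p, hp, hpS⟩ := LinearMap.exists_monic_and_aeval_eq_zero ℤ (S.restrict hS)
  have h2 : recurrence Nat.succ p v = 0 := by
    have h3 := congr((($hpS ⟨v, h1⟩ : M) : ℕ → ℤ))
    rw [aeval_eq_sum_range] at h3
    rw [recurrence, aeval_eq_sum_range]
    simpa [Module.End.pow_restrict _ hS] using h3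
  obtain ⟨q, rfl⟩ := dvd_of_recurrence_eq_zero hf hprim hv h1 h2
  rw [Monic, leadingCoeff_mul] at hp
  exact .of_mul_eq_one _ hp

end Fatou

/-! ### Recurrences with finitely supported right-hand side -/

section Solvability

variable {A : Type*} [AddCommGroup A]

/-- The sequence with `d` leading zeros and `w (n + d) = c * (h n - ∑ i < d, a i * w (n + i))`. -/
def forwardSolution (d : ℕ) (a : ℕ → ℤ) (c : ℤ) (h : ℕ → ℤ) (n : ℕ) : ℤ :=
  if _hn : n < d then 0
  else c * (h (n - d) - ∑ i : Fin d, a i * forwardSolution d a c h (n - d + i))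
termination_by n
decreasing_by have := i.2; omega

/-- If the leading coefficient of `f` is a unit, a recurrence with finitely supported right-hand
side is solved by starting from zero far on the left and computing term by term. -/
theorem exists_recurrence_eq_of_isUnit_leadingCoeff {f : ℤ[X]} (hf : IsUnit f.leadingCoeff)
    {h : ℤ → ℤ} (hh : h.support.Finite) : ∃ v : ℤ → ℤ, recurrence (· + 1) f v = h := by
  obtain ⟨N, hN⟩ := hh.bddBelow
  obtain ⟨c, hc⟩ := hf.exists_right_inv
  set d := f.natDegree
  let w := forwardSolution d f.coeff c fun n => h (N + n)
  have hw0 : ∀ i < d, w i = 0 := fun i hi => by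
    change forwardSolution _ _ _ _ _ = _
    rw [forwardSolution, dif_pos hi]
  have hw : ∀ n : ℕ, w (n + d) = c * (h (N + n) - ∑ i ∈ Finset.range d, f.coeff i * w (n + i)) :=
    fun n => by
      change forwardSolution _ _ _ _ _ = _
      rw [forwardSolution, dif_neg (by omega), Finset.sum_range, Nat.add_sub_cancel]
  refine ⟨fun n => if N ≤ n then w (n - N).toNat else 0, ?_⟩
  ext n
  rw [recurrence_int_apply]
  rcases lt_or_ge n N with hn | hn
  · rw [Finset.sum_eq_zero]
    · by_contra hne
      exact absurd (hN (Function.mem_support.2 (Ne.symm hne))) (not_le.2 hn)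
    · intro i hi
      have := Finset.mem_range.1 hi
      split_ifs with hi'
      · rw [hw0 _ (by omega), smul_zero]
      · rw [smul_zero]
  · obtain ⟨k, rfl⟩ := Int.le.dest hn
    have : ∀ i : ℕ, (if N ≤ N + k + i then w (N + k + i - N).toNat else 0) = w (k + i) := by
      intro i
      rw [if_pos (by omega)]
      congr 1
      omega
    simp_rw [this]
    rw [Finset.sum_range_succ, hw]
    change _ + f.leadingCoeff • _ = _
    simp only [smul_eq_mul]
    linear_combination (h (N + k) - ∑ i ∈ Finset.range d, f.coeff i * w (k + i)) * hc

theorem exists_recurrence_eq_of_isUnit_coeff_zero {f : ℤ[X]} (hf : IsUnit (f.coeff 0))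
    {h : ℤ → ℤ} (hh : h.support.Finite) : ∃ v : ℤ → ℤ, recurrence (· + 1) f v = h := by
  have hrev : IsUnit f.reverse.leadingCoeff := by
    rwa [reverse_leadingCoeff, trailingCoeff, natTrailingDegree_eq_zero.2 (Or.inr hf.ne_zero)]
  obtain ⟨v, hv⟩ := exists_recurrence_eq_of_isUnit_leadingCoeff hrev
    (h := fun n => h (-n - f.natDegree))
    (hh.preimage (f := fun n : ℤ => -n - f.natDegree) fun a _ b _ hab => by
      have : -a - (f.natDegree : ℤ) = -b - f.natDegree := hab
      omega)
  refine ⟨v ∘ Neg.neg, ?_⟩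
  ext n
  rw [← recurrence_reverse hf.ne_zero, recurrence_comp (s := (· + 1)) (t := (· - 1))
    (e := Neg.neg) (fun n => by simp only; ring), hv]
  simp

/-- The extreme nonzero terms of a nonzero finitely supported solution of `f(S) y = h` give rise
to nonzero values of `h` at two places whose distance is at least the degree of `f`. -/
theorem recurrence_ne_single {f : ℤ[X]} (h0 : f.coeff 0 ≠ 0) (hd : f.natDegree ≠ 0) {y : ℤ → ℝ}
    (hy : y.support.Finite) : recurrence (· + 1) f y ≠ Pi.single 0 1 := by
  intro h
  have hne : y.support.Nonempty := by
    rw [Set.nonempty_iff_ne_empty, Ne, Function.support_eq_empty_iff]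
    rintro rfl
    have := congr_fun h 0
    simp [recurrence_int_apply] at this
  obtain ⟨M, hM, hMmax⟩ := hy.exists_maximal hne
  obtain ⟨m, hm, hmmin⟩ := hy.exists_minimal hne
  have hM0 : ∀ n, M < n → y n = 0 := fun n hn => by
    by_contra hy
    exact absurd (hMmax hy hn.le) (not_le.2 hn)
  have hm0 : ∀ n, n < m → y n = 0 := fun n hn => by
    by_contra hy
    exact absurd (hmmin hy hn.le) (not_le.2 hn)
  have key : ∀ n, recurrence (· + 1) f y n ≠ 0 → n = 0 := fun n hn => by
    by_contra hn0
    rw [h, Pi.single_eq_of_ne hn0] at hn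
    exact hn rfl
  have h1 : M = 0 := key M <| by
    rw [recurrence_int_apply, Finset.sum_range_succ', Finset.sum_eq_zero]
    · simpa [h0] using hM
    · intro i _
      rw [hM0 _ (by push_cast; omega), smul_zero]
  have h2 : m - f.natDegree = 0 := key _ <| by
    rw [recurrence_int_apply, Finset.sum_range_succ, Finset.sum_eq_zero]
    · have : f ≠ 0 := by rintro rfl; simp at h0
      simpa [this] using hm
    · intro i hi
      have := Finset.mem_range.1 hi
      rw [hm0 _ (by omega), smul_zero]
  have h3 : m ≤ M := by
    by_contra hlt
    exact hM (hm0 M (not_le.1 hlt))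
  omega

end Solvability

/-! ### The solution of the recurrence with a point mass on the right -/

section FundamentalSolution

open MeasureTheory

theorem tendsto_fourierCoeff_cofinite {T : ℝ} [Fact (0 < T)] (F : C(AddCircle T, ℂ)) :
    Tendsto (fourierCoeff F) cofinite (𝓝 0) := by
  have h1 := (hasSum_sq_fourierCoeff
    (ContinuousMap.toLp 2 AddCircle.haarAddCircle ℂ F)).summable.tendsto_cofinite_zero
  simp_rw [fourierCoeff_toLp] at h1
  rw [tendsto_zero_iff_norm_tendsto_zero]
  simpa using h1.sqrt

/-- If `f` has no roots on the unit circle, the Fourier coefficients of `1 / f` solve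
`f(S) y = δ` and, by the Riemann–Lebesgue lemma, tend to zero. -/
theorem exists_recurrence_eq_single {f : ℤ[X]} (hf : ∀ z : ℂ, ‖z‖ = 1 → aeval z f ≠ 0) :
    ∃ y : ℤ → ℝ, Tendsto y cofinite (𝓝 0) ∧ recurrence (· + 1) f y = Pi.single 0 1 := by
  have hz : ∀ t : UnitAddCircle, ‖fourier (-1) t‖ = 1 := fun t => Circle.norm_coe _
  let F : C(UnitAddCircle, ℂ) :=
    ⟨fun t => (aeval (fourier (-1) t) f)⁻¹, by
      refine Continuous.inv₀ ?_ fun t => hf _ (hz t)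
      exact (Polynomial.continuous_aeval f).comp (map_continuous (fourier (-1)))⟩
  have hF : recurrence (· + 1) f (fourierCoeff F) = Pi.single (0 : ℤ) (1 : ℂ) := by
    ext n
    rw [recurrence_int_apply]
    have h1 : ∀ i : ℕ, f.coeff i • fourierCoeff F (n + i) =
        ∫ t : UnitAddCircle, fourier (-n) t *
          (f.coeff i • fourier (-1) t ^ i * F t) ∂AddCircle.haarAddCircle := fun i => by
      rw [fourierCoeff, zsmul_eq_mul, ← integral_const_mul]
      congr 1
      ext t
      have : (fourier (-(n + i)) t : ℂ) = fourier (-n) t * fourier (-1) t ^ i := by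
        rw [neg_add, fourier_add]
        congr 1
        simp only [fourier_apply, ← Circle.coe_pow, ← AddCircle.toCircle_nsmul]
        simp
      rw [this, smul_eq_mul]
      simp only [zsmul_eq_mul]
      ring
    simp_rw [h1]
    rw [← integral_finsetSum]
    · have h2 : ∀ t : UnitAddCircle, ∑ i ∈ Finset.range (f.natDegree + 1),
          (fourier (-n) t * (f.coeff i • fourier (-1) t ^ i * F t) : ℂ) = fourier (-n) t := by
        intro t
        rw [← Finset.mul_sum, ← Finset.sum_mul, ← aeval_eq_sum_range]
        change _ * (_ * (aeval (fourier (-1) t) f)⁻¹) = _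
        rw [mul_inv_cancel₀ (hf _ (hz t)), mul_one]
      simp_rw [h2]
      have h3 := fourierCoeff_fourier (T := 1) 0
      have h4 := congr_fun h3 n
      rw [fourierCoeff] at h4
      simpa using h4
    · intro i _
      have hc : Continuous fun t : UnitAddCircle =>
          (fourier (-n) t * (f.coeff i • fourier (-1) t ^ i * F t) : ℂ) := by fun_prop
      exact hc.integrable_of_hasCompactSupport (.of_compactSpace _)
  refine ⟨fun n => (fourierCoeff F n).re, ?_, ?_⟩
  · exact (Complex.continuous_re.tendsto' 0 0 rfl).comp (tendsto_fourierCoeff_cofinite F)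
  · have := recurrence_map (Complex.reAddGroupHom) (· + 1) f (fourierCoeff F)
    rw [hF] at this
    refine Eq.trans this ?_
    ext n
    by_cases hn : n = 0
    · subst hn; simp
    · simp [hn]

end FundamentalSolution

/-! ### Polynomials in the shift -/

section PolynomialShift

variable {A : Type*} [AddCommGroup A]

theorem recurrence_add (s : ℤ → ℤ) (p q : ℤ[X]) (u : ℤ → A) :
    recurrence s (p + q) u = recurrence s p u + recurrence s q u := by
  rw [recurrence, map_add]; rfl

theorem recurrence_mul (s : ℤ → ℤ) (p q : ℤ[X]) (u : ℤ → A) :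
    recurrence s (p * q) u = recurrence s p (recurrence s q u) := by
  rw [recurrence, map_mul]; rfl

theorem recurrence_neg (s : ℤ → ℤ) (p : ℤ[X]) (u : ℤ → A) :
    recurrence s (-p) u = -recurrence s p u := by
  rw [recurrence, map_neg]; rfl

theorem recurrence_zero (s : ℤ → ℤ) (p : ℤ[X]) : recurrence s p (0 : ℤ → A) = 0 :=
  map_zero _

theorem recurrence_monomial (k : ℕ) (a : ℤ) (u : ℤ → A) (n : ℤ) :
    recurrence (· + 1) (monomial k a) u n = a • u (n + k) := by
  rw [recurrence, aeval_monomial, Module.End.mul_apply, Algebra.algebraMap_eq_smul_one,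
    LinearMap.smul_apply, Pi.smul_apply, Module.End.one_apply, funLeft_pow_apply,
    add_one_iterate_int]

theorem recurrence_X_pow_mul (k : ℕ) (p : ℤ[X]) (u : ℤ → A) (n : ℤ) :
    recurrence (· + 1) (X ^ k * p) u n = recurrence (· + 1) p u (n + k) := by
  rw [recurrence_mul, ← monomial_one_right_eq_X_pow, recurrence_monomial, one_zsmul]

end PolynomialShift

/-! ### Itineraries -/

namespace AlgDyn

variable {Γ : Type*} [AddCommGroup Γ] [TopologicalSpace Γ] {α : Γ ≃ₜ+ Γ}

theorem Dual.eval_add_right (χ : Dual α) (g h : Γ) : χ.eval (g + h) = χ.eval g * χ.eval h :=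
  map_mul (Additive.toMul χ : PontryaginDual (Multiplicative Γ)) _ _

theorem Dual.eval_zero_right (χ : Dual α) : χ.eval 0 = 1 :=
  map_one (Additive.toMul χ : PontryaginDual (Multiplicative Γ))

theorem Dual.eval_add_left (χ ψ : Dual α) (g : Γ) : (χ + ψ).eval g = χ.eval g * ψ.eval g := rfl

theorem Dual.eval_zsmul_left (a : ℤ) (χ : Dual α) (g : Γ) : (a • χ).eval g = χ.eval g ^ a := by
  let E : Dual α →+ Additive Circle :=
    { toFun := fun ψ => Additive.ofMul (ψ.eval g), map_zero' := rfl, map_add' := fun _ _ => rfl }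
  exact map_zsmul E a χ

theorem Dual.continuous_eval (χ : Dual α) : Continuous χ.eval :=
  (map_continuous (Additive.toMul χ : PontryaginDual (Multiplicative Γ))).comp continuous_ofAdd

/-- The logarithm from the unit circle of `ℂ` to `ℝ / ℤ`. -/
noncomputable def circleLog (z : Circle) : UnitAddCircle :=
  (AddCircle.homeomorphCircle one_ne_zero).symm z

theorem toCircle_circleLog (z : Circle) : (circleLog z).toCircle = z := by
  rw [← AddCircle.homeomorphCircle_apply one_ne_zero]
  exact Homeomorph.apply_symm_apply _ z

theorem toCircle_inj {x y : UnitAddCircle} : x.toCircle = y.toCircle ↔ x = y :=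
  (AddCircle.injective_toCircle one_ne_zero).eq_iff

/-- The itinerary `n ↦ χ(αⁿ g)` of `g`, written additively in `ℝ / ℤ`. -/
noncomputable def Dual.code (χ : Dual α) : Γ →+ (ℤ → UnitAddCircle) where
  toFun g n := circleLog (((T n : ℤ[T;T⁻¹]) • χ).eval g)
  map_zero' := by
    ext n
    rw [← toCircle_inj, toCircle_circleLog, Dual.eval_zero_right]
    exact AddCircle.toCircle_zero.symm
  map_add' g h := by
    ext n
    rw [← toCircle_inj, toCircle_circleLog, Dual.eval_add_right, Pi.add_apply,
      AddCircle.toCircle_add, toCircle_circleLog, toCircle_circleLog]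

theorem toCircle_code (χ : Dual α) (g : Γ) (n : ℤ) :
    (χ.code g n).toCircle = ((T n : ℤ[T;T⁻¹]) • χ).eval g :=
  toCircle_circleLog _

/-- The itinerary map carries `α` to the shift. -/
theorem code_iter (χ : Dual α) (k : ℤ) (g : Γ) (n : ℤ) :
    χ.code (iter α k g) n = χ.code g (k + n) := by
  rw [← toCircle_inj, toCircle_code, toCircle_code, T_add, mul_smul, ← T_smul_eval]

theorem continuous_code (χ : Dual α) : Continuous χ.code :=
  continuous_pi fun _ => (Homeomorph.continuous_symm _).comp (Dual.continuous_eval _)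

theorem toCircle_recurrence_code (χ : Dual α) (q : ℤ[X]) (g : Γ) (n : ℤ) :
    (recurrence (· + 1) q (χ.code g) n).toCircle =
      ((T n * toLaurent q : ℤ[T;T⁻¹]) • χ).eval g := by
  induction q using Polynomial.induction_on' with
  | add p q hp hq =>
    rw [recurrence_add, Pi.add_apply, AddCircle.toCircle_add, hp, hq, map_add, mul_add, add_smul,
      Dual.eval_add_left]
  | monomial k a =>
    rw [recurrence_monomial, AddCircle.toCircle_zsmul, toCircle_code, ← Dual.eval_zsmul_left,
      ← Polynomial.C_mul_X_pow_eq_monomial, toLaurent_C_mul_X_pow, T_add,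
      ← Int.cast_smul_eq_zsmul ℤ[T;T⁻¹], smul_smul, eq_intCast]
    congr 2
    ring

theorem exists_shift_toLaurent (p : ℤ[T;T⁻¹]) : ∃ (n : ℤ) (q : ℤ[X]), p = T n * toLaurent q := by
  obtain ⟨k, q, hq⟩ := LaurentPolynomial.exists_T_pow p
  refine ⟨-k, q, ?_⟩
  rw [hq, T_mul, mul_T_assoc, add_neg_cancel, T_zero, mul_one]

/-- The characters in the cyclic submodule generated by `χ` are the integer linear combinations of
the coordinates of the itinerary. -/
theorem smul_eval_eq_one_of_code_eq_zero {χ : Dual α} {g : Γ} (h : χ.code g = 0)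
    (p : ℤ[T;T⁻¹]) : (p • χ).eval g = 1 := by
  obtain ⟨n, q, rfl⟩ := exists_shift_toLaurent p
  rw [← toCircle_recurrence_code, h, recurrence_zero]
  exact AddCircle.toCircle_zero

theorem recurrence_code_eq_zero {χ : Dual α} {f : ℤ[X]}
    (hf : Module.annihilator ℤ[T;T⁻¹] (Dual α) = Ideal.span {toLaurent f}) (g : Γ) :
    recurrence (· + 1) f (χ.code g) = 0 := by
  ext n
  have h1 : (T n * toLaurent f : ℤ[T;T⁻¹]) ∈ Module.annihilator ℤ[T;T⁻¹] (Dual α) := by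
    rw [hf]
    exact Ideal.mul_mem_left _ _ (Ideal.mem_span_singleton_self _)
  rw [← toCircle_inj, toCircle_recurrence_code, Module.mem_annihilator.1 h1]
  exact AddCircle.toCircle_zero.symm

variable [IsTopologicalAddGroup Γ] [CompactSpace Γ] [T2Space Γ]

/-- The itinerary map is injective, because the characters of `Γ` separate its points. -/
theorem code_injective {χ : Dual α} (hχ : ∀ ψ : Dual α, ∃ p : ℤ[T;T⁻¹], ψ = p • χ) :
    Function.Injective χ.code := by
  rw [injective_iff_map_eq_zero]
  intro g hg
  by_contra hne
  have : T2Space (Multiplicative Γ) := inferInstanceAs (T2Space Γ)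
  obtain ⟨ψ, hψ⟩ := exists_character_ne_one (G := Multiplicative Γ)
    (g := Multiplicative.ofAdd g) (by simpa using hne)
  obtain ⟨p, hp⟩ := hχ (Additive.ofMul (ψ : PontryaginDual (Multiplicative Γ)))
  apply hψ
  have := smul_eval_eq_one_of_code_eq_zero hg p
  rw [← hp] at this
  exact this

theorem isClosedEmbedding_code {χ : Dual α} (hχ : ∀ ψ : Dual α, ∃ p : ℤ[T;T⁻¹], ψ = p • χ) :
    IsClosedEmbedding χ.code :=
  (continuous_code χ).isClosedEmbedding (code_injective hχ)

end AlgDyn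

/-! ### The range of the itinerary map -/

section TrigonometricPolynomials

/-- The character `z ↦ exp (2πi (q(S) z)(n))` of the group `(ℝ / ℤ) ^ ℤ`. -/
noncomputable def shiftCharacter (q : ℤ[X]) (n : ℤ) : C(ℤ → UnitAddCircle, ℂ) where
  toFun z := (recurrence (· + 1) q z n).toCircle
  continuous_toFun := by
    simp only [recurrence_int_apply]
    exact continuous_subtype_val.comp <| AddCircle.continuous_toCircle.comp <|
      continuous_finsetSum _ fun i _ => (continuous_zsmul (q.coeff i)).comp (continuous_apply _)

theorem shiftCharacter_apply (q : ℤ[X]) (n : ℤ) (z : ℤ → UnitAddCircle) :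
    shiftCharacter q n z = (recurrence (· + 1) q z n).toCircle := rfl

theorem shiftCharacter_add (q : ℤ[X]) (n : ℤ) (z w : ℤ → UnitAddCircle) :
    shiftCharacter q n (z + w) = shiftCharacter q n z * shiftCharacter q n w := by
  have : recurrence (· + 1) q (z + w) n = recurrence (· + 1) q z n + recurrence (· + 1) q w n := by
    rw [recurrence, map_add]; rfl
  simp only [shiftCharacter_apply]
  rw [this, AddCircle.toCircle_add, Circle.coe_mul]

/-- The characters `shiftCharacter q n` are closed under multiplication. -/
def shiftCharacters : Submonoid C(ℤ → UnitAddCircle, ℂ) where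
  carrier := {e | ∃ q n, e = shiftCharacter q n}
  one_mem' := ⟨0, 0, by
    ext z
    rw [shiftCharacter_apply, recurrence, map_zero]
    simp⟩
  mul_mem' := by
    -- the two base points are moved to the smaller one by powers of `X`
    have key : ∀ (q q' : ℤ[X]) (n : ℤ) (k : ℕ),
        shiftCharacter q n * shiftCharacter q' (n + k) = shiftCharacter (q + X ^ k * q') n := by
      intro q q' n k
      ext z
      rw [ContinuousMap.mul_apply]
      simp only [shiftCharacter_apply]
      rw [recurrence_add, Pi.add_apply, recurrence_X_pow_mul, AddCircle.toCircle_add,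
        Circle.coe_mul]
    rintro - - ⟨q, n, rfl⟩ ⟨q', n', rfl⟩
    rcases le_total n n' with h | h
    · obtain ⟨k, rfl⟩ := Int.le.dest h
      exact ⟨_, _, key q q' n k⟩
    · obtain ⟨k, rfl⟩ := Int.le.dest h
      exact ⟨_, _, (mul_comm _ _).trans (key q' q n' k)⟩

/-- Trigonometric polynomials in the coordinates of `(ℝ / ℤ) ^ ℤ`. -/
noncomputable def shiftSubalgebra : StarSubalgebra ℂ C(ℤ → UnitAddCircle, ℂ) where
  toSubalgebra := Algebra.adjoin ℂ shiftCharacters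
  star_mem' := by
    change Algebra.adjoin ℂ (shiftCharacters : Set C(ℤ → UnitAddCircle, ℂ)) ≤
      star (Algebra.adjoin ℂ (shiftCharacters : Set C(ℤ → UnitAddCircle, ℂ)))
    refine Algebra.adjoin_le ?_
    rintro - ⟨q, n, rfl⟩
    refine Algebra.subset_adjoin ⟨-q, n, ?_⟩
    ext z
    rw [ContinuousMap.star_apply, shiftCharacter_apply, shiftCharacter_apply, recurrence_neg,
      Pi.neg_apply, AddCircle.toCircle_neg, Circle.coe_inv_eq_conj]
    rfl

theorem shiftSubalgebra_separatesPoints : shiftSubalgebra.SeparatesPoints := by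
  intro z w hzw
  obtain ⟨n, hn⟩ := Function.ne_iff.1 hzw
  refine ⟨_, ⟨shiftCharacter 1 n, Algebra.subset_adjoin ⟨1, n, rfl⟩, rfl⟩, ?_⟩
  intro h
  replace h : shiftCharacter 1 n z = shiftCharacter 1 n w := h
  rw [shiftCharacter_apply, shiftCharacter_apply, recurrence, recurrence, map_one,
    Module.End.one_apply, Module.End.one_apply] at h
  exact hn (AlgDyn.toCircle_inj.1 (Circle.ext h))

/-- By the Stone–Weierstrass theorem, an equality of continuous linear functionals on
`C((ℝ / ℤ) ^ ℤ, ℂ)` can be tested on the characters `shiftCharacter q n`. -/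
theorem continuousLinearMap_ext_shiftCharacter {I J : C(ℤ → UnitAddCircle, ℂ) →L[ℂ] ℂ}
    (h : ∀ q n, I (shiftCharacter q n) = J (shiftCharacter q n)) : I = J := by
  have h1 := ContinuousMap.starSubalgebra_topologicalClosure_eq_top_of_separatesPoints
    shiftSubalgebra shiftSubalgebra_separatesPoints
  have hspan : Subalgebra.toSubmodule shiftSubalgebra.toSubalgebra =
      Submodule.span ℂ (shiftCharacters : Set C(ℤ → UnitAddCircle, ℂ)) := by
    change Subalgebra.toSubmodule (Algebra.adjoin ℂ _) = _
    rw [Algebra.adjoin_eq_span, Submonoid.closure_eq]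
  refine ContinuousLinearMap.ext_on (s := shiftCharacters) ?_ ?_
  · rw [← hspan, dense_iff_closure_eq]
    have h2 := congr_arg (fun S : StarSubalgebra ℂ C(ℤ → UnitAddCircle, ℂ) =>
      (S : Set C(ℤ → UnitAddCircle, ℂ))) h1
    simpa using h2
  · rintro - ⟨q, n, rfl⟩
    exact h q n

end TrigonometricPolynomials

namespace AlgDyn

variable {Γ : Type*} [AddCommGroup Γ] [TopologicalSpace Γ] {α : Γ ≃ₜ+ Γ}

/-- The functional `F ↦ ∫ F (c x) dμ(x)` on `C(Y, ℂ)` given by a continuous map `c : X → Y` and a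
probability measure `μ` on `X`. -/
noncomputable def integralComp {X Y : Type*} [TopologicalSpace X] [CompactSpace X]
    [TopologicalSpace Y] [CompactSpace Y] [MeasurableSpace X] [BorelSpace X]
    (μ : MeasureTheory.Measure X) [MeasureTheory.IsProbabilityMeasure μ] (c : C(X, Y)) :
    C(Y, ℂ) →L[ℂ] ℂ :=
  LinearMap.mkContinuous
    { toFun := fun F => ∫ x, F (c x) ∂μ
      map_add' := fun F F' => by
        refine MeasureTheory.integral_add ?_ ?_ <;>
        exact ((map_continuous _).comp (map_continuous c)).integrable_of_hasCompactSupport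
          (.of_compactSpace _)
      map_smul' := fun a F => MeasureTheory.integral_smul a _ }
    1 fun F => by
      have := MeasureTheory.norm_integral_le_of_norm_le_const (μ := μ) (f := fun x => F (c x))
        (.of_forall fun x => F.norm_coe_le_norm (c x))
      simpa using this

theorem integralComp_apply {X Y : Type*} [TopologicalSpace X] [CompactSpace X]
    [TopologicalSpace Y] [CompactSpace Y] [MeasurableSpace X] [BorelSpace X]
    (μ : MeasureTheory.Measure X) [MeasureTheory.IsProbabilityMeasure μ] (c : C(X, Y))
    (F : C(Y, ℂ)) : integralComp μ c F = ∫ x, F (c x) ∂μ := rfl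

/-- A relation `T n * q ∈ (f)` in the Laurent polynomial ring descends to polynomials. -/
theorem exists_mul_eq_X_pow_mul {f q : ℤ[X]} {n : ℤ}
    (h : (T n * toLaurent q : ℤ[T;T⁻¹]) ∈ Ideal.span {toLaurent f}) :
    ∃ (r : ℤ[X]) (k : ℕ), r * f = X ^ k * q := by
  obtain ⟨s, hs⟩ := Ideal.mem_span_singleton'.1 h
  obtain ⟨m, r, rfl⟩ := exists_shift_toLaurent s
  refine ⟨X ^ (m - n).toNat * r, (n - m).toNat, toLaurent_injective ?_⟩
  simp only [map_mul, toLaurent_X_pow]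
  have h1 : (toLaurent r * toLaurent f : ℤ[T;T⁻¹]) = T (n - m) * toLaurent q := by
    have := congr(T (-m) * $hs)
    rw [← mul_assoc, ← mul_assoc, ← T_add, ← mul_assoc, ← T_add, neg_add_cancel, T_zero,
      one_mul] at this
    rw [this]
    congr 2
    ring
  rw [mul_assoc, h1, ← mul_assoc, ← T_add]
  congr 2
  omega

variable [IsTopologicalAddGroup Γ] [CompactSpace Γ] [T2Space Γ]

open MeasureTheory in
/-- The itineraries are all the solutions of the recurrence `f(S) z = 0` in `ℝ / ℤ`. If `z` is a
solution, then the Haar measure of the range of the itinerary map and its translate by `z` have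
the same integrals of characters, so they are equal, and `z` is in the range. -/
theorem exists_code_eq {χ : Dual α} (hχ : ∀ ψ : Dual α, ∃ p : ℤ[T;T⁻¹], ψ = p • χ) {f : ℤ[X]}
    (hf : Module.annihilator ℤ[T;T⁻¹] (Dual α) = Ideal.span {toLaurent f})
    {z : ℤ → UnitAddCircle} (hz : recurrence (· + 1) f z = 0) : ∃ g, χ.code g = z := by
  borelize Γ
  obtain ⟨μ, _, _⟩ : ∃ μ : Measure Γ, IsProbabilityMeasure μ ∧ μ.IsAddLeftInvariant :=
    ⟨Measure.addHaarMeasure ⊤, ⟨Measure.addHaarMeasure_self (K₀ := ⊤)⟩, inferInstance⟩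
  let c : C(Γ, ℤ → UnitAddCircle) := ⟨χ.code, continuous_code χ⟩
  let c' : C(Γ, ℤ → UnitAddCircle) := ⟨fun g => z + χ.code g, (continuous_code χ).const_add z⟩
  have hIJ : integralComp μ c = integralComp μ c' := by
    refine continuousLinearMap_ext_shiftCharacter fun q n => ?_
    rw [integralComp_apply, integralComp_apply]
    change ∫ g, shiftCharacter q n (χ.code g) ∂μ = ∫ g, shiftCharacter q n (z + χ.code g) ∂μ
    simp_rw [shiftCharacter_add]
    rw [integral_const_mul]
    by_cases htriv : ∀ g, shiftCharacter q n (χ.code g) = 1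
    -- A character that is trivial on itineraries comes from an element of `(f)`, so it kills `z`.
    · have hann : (T n * toLaurent q : ℤ[T;T⁻¹]) ∈ Module.annihilator ℤ[T;T⁻¹] (Dual α) := by
        refine Module.mem_annihilator.2 fun ψ => ?_
        obtain ⟨p, rfl⟩ := hχ ψ
        rw [smul_comm]
        have h0 : (T n * toLaurent q : ℤ[T;T⁻¹]) • χ = 0 := Dual.ext fun g => by
          rw [← toCircle_recurrence_code]
          exact Circle.ext (htriv g)
        rw [h0, smul_zero]
      rw [hf] at hann
      obtain ⟨r, k, hr⟩ := exists_mul_eq_X_pow_mul hann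
      have h1 : recurrence (· + 1) q z n = 0 := by
        have h2 := recurrence_X_pow_mul k q z (n - k)
        rw [sub_add_cancel, ← hr, recurrence_mul, hz, recurrence_zero] at h2
        exact h2.symm
      rw [shiftCharacter_apply _ _ z, h1, AddCircle.toCircle_zero, Circle.coe_one, one_mul]
    -- Otherwise it has mean zero over the itineraries, hence over their translate by `z`.
    · push Not at htriv
      obtain ⟨h, hh⟩ := htriv
      have h0 : ∫ g, shiftCharacter q n (χ.code g) ∂μ = 0 := by
        have h1 := integral_add_left_eq_self (μ := μ) (fun g => shiftCharacter q n (χ.code g)) h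
        simp_rw [map_add, shiftCharacter_add] at h1
        rw [integral_const_mul] at h1
        exact (mul_left_eq_self₀.1 h1).resolve_left hh
      rw [h0, mul_zero]
  by_contra hne
  push Not at hne
  have hcl := isClosedEmbedding_code hχ
  have hcl' : IsClosed (Set.range c') := (isCompact_range (map_continuous c')).isClosed
  obtain ⟨F, hF0, hF1, -⟩ := exists_continuous_zero_one_of_isClosed hcl.isClosed_range hcl' <| by
    rw [Set.disjoint_left]
    rintro - ⟨g, rfl⟩ ⟨h, hh⟩
    apply hne (g - h)
    rw [map_sub, ← hh]
    exact add_sub_cancel_right _ _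
  let F' : C(ℤ → UnitAddCircle, ℂ) := ⟨fun x => F x, by fun_prop⟩
  have h1 := congr($hIJ F')
  rw [integralComp_apply, integralComp_apply] at h1
  have h2 : ∀ g, F' (c g) = 0 := fun g => by
    change ((F (c g) : ℝ) : ℂ) = 0
    rw [show F (c g) = 0 from hF0 ⟨g, rfl⟩, Complex.ofReal_zero]
  have h3 : ∀ g, F' (c' g) = 1 := fun g => by
    change ((F (c' g) : ℝ) : ℂ) = 1
    rw [show F (c' g) = 1 from hF1 ⟨g, rfl⟩, Complex.ofReal_one]
  simp [h2, h3] at h1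

end AlgDyn

/-! ### Real lifts of sequences in the circle -/

section RealLifts

theorem recurrence_coe (s : ℤ → ℤ) (f : ℤ[X]) (u : ℤ → ℝ) :
    recurrence s f (fun n => (u n : UnitAddCircle)) =
      fun n => ((recurrence s f u n : ℝ) : UnitAddCircle) :=
  recurrence_map (QuotientAddGroup.mk' (AddSubgroup.zmultiples (1 : ℝ))) s f u

theorem recurrence_intCast (s : ℤ → ℤ) (f : ℤ[X]) (v : ℤ → ℤ) :
    recurrence s f (fun n => (v n : ℝ)) = fun n => ((recurrence s f v n : ℤ) : ℝ) :=
  recurrence_map (Int.castAddHom ℝ) s f v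

theorem recurrence_sub (s : ℤ → ℤ) (f : ℤ[X]) (u v : ℤ → ℝ) :
    recurrence s f (fun n => u n - v n) = recurrence s f u - recurrence s f v :=
  map_sub (aeval (LinearMap.funLeft ℤ ℝ s : Module.End ℤ (ℤ → ℝ)) f) u v

theorem recurrence_const_mul (f : ℤ[X]) (t : ℝ) (u : ℤ → ℝ) (n : ℤ) :
    recurrence (· + 1) f (fun n => t * u n) n = t * recurrence (· + 1) f u n := by
  simp only [recurrence_int_apply, Finset.mul_sum]
  exact Finset.sum_congr rfl fun i _ => by simp only [zsmul_eq_mul]; ring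

theorem coe_unitAddCircle_eq_zero_iff {x : ℝ} : (x : UnitAddCircle) = 0 ↔ ∃ k : ℤ, (k : ℝ) = x := by
  rw [AddCircle.coe_eq_zero_iff]
  simp only [zsmul_eq_mul, mul_one]

theorem exists_intCast_eq_of_coe_eq_zero {u : ℤ → ℝ} (h : ∀ n, (u n : UnitAddCircle) = 0) :
    ∃ v : ℤ → ℤ, ∀ n, (v n : ℝ) = u n :=
  ⟨_, fun n => (coe_unitAddCircle_eq_zero_iff.1 (h n)).choose_spec⟩

theorem exists_real_lift_tendsto {z : ℤ → UnitAddCircle} (hz : Tendsto z cofinite (𝓝 0)) :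
    ∃ x : ℤ → ℝ, Tendsto x cofinite (𝓝 0) ∧ ∀ n, (x n : UnitAddCircle) = z n := by
  have h : ∀ y : UnitAddCircle, ∃ x : ℝ, (x : UnitAddCircle) = y ∧ |x| = ‖y‖ := fun y => by
    induction y using QuotientAddGroup.induction_on with
    | H x =>
    refine ⟨x - round x, ?_, UnitAddCircle.norm_eq.symm⟩
    rw [AddCircle.coe_sub, coe_unitAddCircle_eq_zero_iff.2 ⟨round x, rfl⟩, sub_zero]
  choose ℓ h1 h2 using h
  refine ⟨fun n => ℓ (z n), ?_, fun n => h1 _⟩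
  rw [tendsto_zero_iff_norm_tendsto_zero] at hz ⊢
  simpa only [Real.norm_eq_abs, h2] using hz

theorem tendsto_recurrence_cofinite (f : ℤ[X]) {x : ℤ → ℝ} (hx : Tendsto x cofinite (𝓝 0)) :
    Tendsto (recurrence (· + 1) f x) cofinite (𝓝 0) := by
  have h1 : recurrence (· + 1) f x =
      fun n => ∑ i ∈ Finset.range (f.natDegree + 1), f.coeff i • x (n + i) :=
    funext (recurrence_int_apply f x)
  rw [h1, ← Finset.sum_const_zero (s := Finset.range (f.natDegree + 1)) (M := ℝ)]
  refine tendsto_finsetSum _ fun i _ => ?_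
  have h2 := hx.comp (add_left_injective (i : ℤ)).tendsto_cofinite
  simpa using h2.const_smul (f.coeff i)

theorem finite_support_of_tendsto {v : ℤ → ℤ}
    (hv : Tendsto (fun n => (v n : ℝ)) cofinite (𝓝 0)) : v.support.Finite := by
  have h1 := hv.eventually (Metric.ball_mem_nhds 0 one_pos)
  refine (eventually_cofinite.1 h1).subset fun n hn => ?_
  rw [Function.mem_support] at hn
  have h2 : (1 : ℝ) ≤ |(v n : ℝ)| := by exact_mod_cast Int.one_le_abs hn
  simpa using h2

theorem exists_bound_of_tendsto {u : ℤ → ℝ} (hu : Tendsto u cofinite (𝓝 0)) :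
    ∃ C, ∀ n, |u n| ≤ C := by
  have h1 : Tendsto (fun n => |u n|) cofinite (𝓝 0) := by simpa using hu.abs
  obtain ⟨C, hC⟩ := h1.bddAbove_range_of_cofinite
  exact ⟨C, fun n => hC ⟨n, rfl⟩⟩

end RealLifts

/-! ### Polynomials monic up to a sign -/

section MonicUpToSign

theorem coeff_toLaurent_natCast (f : ℤ[X]) (i : ℕ) : (toLaurent f).coeff (i : ℤ) = f.coeff i := by
  rw [coeff_toLaurent]
  exact Finsupp.mapDomain_apply Nat.cast_injective _ _

theorem exists_natCast_of_coeff_toLaurent_ne_zero {f : ℤ[X]} {n : ℤ}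
    (h : (toLaurent f).coeff n ≠ 0) : ∃ i : ℕ, (i : ℤ) = n := by
  by_contra hn
  apply h
  rw [coeff_toLaurent]
  exact Finsupp.mapDomain_of_notMem_range _ _ hn

theorem isMonicUpToSign_toLaurent_iff {f : ℤ[X]} :
    AlgDyn.IsMonicUpToSign (toLaurent f) ↔ IsUnit f.leadingCoeff := by
  rw [Int.isUnit_iff]
  constructor
  · rintro ⟨n, hn, hm⟩
    obtain ⟨i, rfl⟩ := exists_natCast_of_coeff_toLaurent_ne_zero (f := f) (n := n) (by omega)
    rw [coeff_toLaurent_natCast] at hn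
    have : f.natDegree = i := natDegree_eq_of_le_of_coeff_ne_zero
      (natDegree_le_iff_coeff_eq_zero.2 fun j hj => by
        rw [← coeff_toLaurent_natCast]
        exact hm _ (by exact_mod_cast hj)) (by omega)
    rwa [leadingCoeff, this]
  · intro h
    refine ⟨f.natDegree, by rwa [coeff_toLaurent_natCast], fun m hm => ?_⟩
    by_contra hne
    obtain ⟨i, rfl⟩ := exists_natCast_of_coeff_toLaurent_ne_zero hne
    rw [coeff_toLaurent_natCast] at hne
    exact hne (coeff_eq_zero_of_natDegree_lt (by exact_mod_cast hm))

theorem isMonicUpToSign_invert_toLaurent_iff {f : ℤ[X]} (hf : f.coeff 0 ≠ 0) :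
    AlgDyn.IsMonicUpToSign (invert (toLaurent f)) ↔ IsUnit (f.coeff 0) := by
  have h0 := coeff_toLaurent_natCast f 0
  rw [Nat.cast_zero] at h0
  rw [Int.isUnit_iff]
  constructor
  · rintro ⟨n, hn, hm⟩
    rw [invert_apply] at hn
    obtain ⟨i, hi⟩ := exists_natCast_of_coeff_toLaurent_ne_zero (f := f) (n := -n) (by omega)
    rcases Nat.eq_zero_or_pos i with rfl | hpos
    · rwa [← hi, coeff_toLaurent_natCast] at hn
    · have := hm 0 (by omega)
      rw [invert_apply, neg_zero, h0] at this
      exact absurd this hf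
  · intro h
    refine ⟨0, by rwa [invert_apply, neg_zero, h0], fun m hm => ?_⟩
    rw [invert_apply]
    by_contra hne
    obtain ⟨i, hi⟩ := exists_natCast_of_coeff_toLaurent_ne_zero hne
    omega

end MonicUpToSign

/-! ### Integer solutions outside a finite set -/

section FiniteSupport

/-- By Fatou's lemma on both half-lines, an integer solution of `f(S) v = h` with finitely
supported `h` is finitely supported unless an extreme coefficient of `f` is a unit. -/
theorem finite_support_of_recurrence {f : ℤ[X]} (hf : Irreducible f) (hprim : f.IsPrimitive)
    (h0 : f.coeff 0 ≠ 0) (hlead : ¬ IsUnit f.leadingCoeff) (htrail : ¬ IsUnit (f.coeff 0))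
    {v : ℤ → ℤ} (hv : (recurrence (· + 1) f v).support.Finite) : v.support.Finite := by
  obtain ⟨a, ha⟩ := hv.bddBelow
  obtain ⟨b, hb⟩ := hv.bddAbove
  have hzero : ∀ n, n < a ∨ b < n → recurrence (· + 1) f v n = 0 := fun n hn => by
    by_contra hne
    have h1 := ha hne
    have h2 := hb hne
    omega
  have hright : v ∘ (fun k : ℕ => b + 1 + (k : ℤ)) = 0 := by
    by_contra hne
    refine hlead (isUnit_leadingCoeff_of_recurrence hf hprim hne ?_)
    rw [recurrence_comp (s := (· + 1)) (fun k => by push_cast; ring)]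
    exact funext fun k => hzero (b + 1 + k) (by omega)
  have hd : f.reverse.leadingCoeff = f.coeff 0 := by
    rw [reverse_leadingCoeff, trailingCoeff, natTrailingDegree_eq_zero.2 (Or.inr h0)]
  have hleft : v ∘ (fun k : ℕ => a - 1 - (k : ℤ)) = 0 := by
    by_contra hne
    have hirr := irreducible_reverse hf h0
    have hdeg : f.reverse.natDegree ≠ 0 := by
      rw [reverse_natDegree, natTrailingDegree_eq_zero.2 (Or.inr h0), Nat.sub_zero]
      exact natDegree_ne_zero_of_isPrimitive hf hprim
    refine htrail (hd ▸ isUnit_leadingCoeff_of_recurrence hirr (hirr.isPrimitive hdeg) hne ?_)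
    rw [recurrence_comp (s := (· - 1)) (fun k => by push_cast; ring)]
    refine funext fun k => ?_
    have := recurrence_reverse h0 v (a - 1 - k - f.natDegree)
    rw [sub_add_cancel] at this
    exact this.trans (hzero _ (by omega))
  refine (Set.finite_Icc a b).subset fun n hn => ?_
  rw [Function.mem_support] at hn
  by_contra hn'
  rw [Set.mem_Icc, not_and_or, not_le, not_le] at hn'
  apply hn
  rcases hn' with h | h
  · have := congr_fun hleft (a - 1 - n).toNat
    rwa [Function.comp_apply, Int.toNat_of_nonneg (by omega), sub_sub_cancel] at this
  · have := congr_fun hright (n - (b + 1)).toNat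
    rwa [Function.comp_apply, Int.toNat_of_nonneg (by omega), add_sub_cancel] at this

end FiniteSupport

/-! ### Homoclinic points and the path component of the identity -/

namespace AlgDyn

variable {Γ : Type*} [AddCommGroup Γ] [TopologicalSpace Γ] {α : Γ ≃ₜ+ Γ} {χ : Dual α}

/-- A path starting at `0` lifts coordinatewise to a path of real sequences; the recurrence stays
integer-valued along it, hence vanishes. -/
theorem exists_real_solution_of_mem_pathComponent {f : ℤ[X]}
    (hf : Module.annihilator ℤ[T;T⁻¹] (Dual α) = Ideal.span {toLaurent f}) {g : Γ}
    (hg : g ∈ pathComponent (0 : Γ)) :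
    ∃ u : ℤ → ℝ, recurrence (· + 1) f u = 0 ∧ ∀ n, (u n : UnitAddCircle) = χ.code g n := by
  obtain ⟨γ⟩ := hg
  have cov := AddCircle.isCoveringMap_coe (1 : ℝ)
  let c : ℤ → C(unitInterval, UnitAddCircle) := fun n =>
    ⟨fun t => χ.code (γ t) n, (continuous_apply n).comp ((continuous_code χ).comp γ.continuous)⟩
  have hc0 : ∀ n, c n 0 = ((0 : ℝ) : UnitAddCircle) := fun n => by
    change χ.code (γ 0) n = 0
    rw [γ.source, map_zero, Pi.zero_apply]
  let L : ℤ → C(unitInterval, ℝ) := fun n => cov.liftPath (c n) 0 (hc0 n)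
  have hL : ∀ n t, ((L n t : ℝ) : UnitAddCircle) = χ.code (γ t) n := fun n t =>
    congr_fun (cov.liftPath_lifts (c n) 0 (hc0 n)) t
  have hL0 : ∀ n, L n 0 = 0 := fun n => cov.liftPath_zero (c n) 0 (hc0 n)
  refine ⟨fun n => L n 1, ?_, fun n => by rw [hL, γ.target]⟩
  ext m
  have hcont : Continuous fun t => recurrence (· + 1) f (fun n => L n t) m := by
    simp only [recurrence_int_apply]
    fun_prop
  have h1 : (fun t => recurrence (· + 1) f (fun n => L n t) m) = fun _ => 0 := by
    refine cov.eq_of_comp_eq hcont continuous_const ?_ 0 ?_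
    · ext t
      have h2 := recurrence_coe (· + 1) f (fun n => L n t)
      simp only [hL] at h2
      change ((recurrence (· + 1) f (fun n => L n t) m : ℝ) : UnitAddCircle) = (0 : ℝ)
      rw [← congr_fun h2 m]
      exact congr_fun (recurrence_code_eq_zero hf (γ t)) m
    · simp only [hL0]
      exact congr_fun (recurrence_zero (· + 1) f) m
  exact congr_fun h1 1

variable [IsTopologicalAddGroup Γ] [CompactSpace Γ] [T2Space Γ]

theorem tendsto_iter_iff (hχ : ∀ ψ : Dual α, ∃ p : ℤ[T;T⁻¹], ψ = p • χ) {l : Filter ℤ}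
    (hl : ∀ m : ℤ, Tendsto (fun n => n + m) l l) (g : Γ) :
    Tendsto (fun n => iter α n g) l (𝓝 0) ↔ Tendsto (χ.code g) l (𝓝 0) := by
  rw [(isClosedEmbedding_code hχ).isEmbedding.tendsto_nhds_iff, map_zero, tendsto_pi_nhds]
  simp only [Function.comp_apply, code_iter, Pi.zero_apply]
  exact ⟨fun h => by simpa using h 0, fun h m => h.comp (hl m)⟩

theorem mem_homoclinicGroup_iff (hχ : ∀ ψ : Dual α, ∃ p : ℤ[T;T⁻¹], ψ = p • χ) (g : Γ) :
    g ∈ homoclinicGroup α ↔ Tendsto (χ.code g) cofinite (𝓝 0) := by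
  rw [Int.cofinite_eq, tendsto_sup,
    ← tendsto_iter_iff hχ (fun m => tendsto_atTop_add_const_right _ m tendsto_id),
    ← tendsto_iter_iff hχ (fun m => tendsto_atBot_add_const_right _ m tendsto_id)]
  exact and_comm

/-- A sufficiently small real solution of the recurrence reduces modulo `1` to a point whose orbit
stays in a prescribed neighbourhood of `0`, so it vanishes by expansiveness. -/
theorem exists_pos_forall_solution_eq_zero (hexp : IsExpansive α)
    (hχ : ∀ ψ : Dual α, ∃ p : ℤ[T;T⁻¹], ψ = p • χ) {f : ℤ[X]}
    (hf : Module.annihilator ℤ[T;T⁻¹] (Dual α) = Ideal.span {toLaurent f}) :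
    ∃ δ > 0, ∀ u : ℤ → ℝ, recurrence (· + 1) f u = 0 → (∀ n, |u n| < δ) → u = 0 := by
  obtain ⟨U, hU, hUexp⟩ := hexp
  rw [(isClosedEmbedding_code hχ).isEmbedding.nhds_eq_comap, map_zero, nhds_pi, mem_comap] at hU
  obtain ⟨V, hV, hVU⟩ := hU
  obtain ⟨I, hI, t, ht, htV⟩ := Filter.mem_pi.1 hV
  have h1 : ∀ᶠ x : ℝ in 𝓝 0, ∀ i ∈ I, (x : UnitAddCircle) ∈ t i := by
    rw [Filter.eventually_all_finite hI]
    exact fun i _ => (AddCircle.continuous_mk' (1 : ℝ)).tendsto' 0 0 rfl (ht i)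
  obtain ⟨δ, hδ, hδt⟩ := Metric.eventually_nhds_iff.1 h1
  refine ⟨min δ 1, lt_min hδ one_pos, fun u hu hsmall => ?_⟩
  obtain ⟨g, hg⟩ := exists_code_eq hχ hf (z := fun n => (u n : UnitAddCircle)) (by
    rw [recurrence_coe, hu]; rfl)
  have hmem : g ∈ ⋂ n : ℤ, iter α n '' U := by
    refine Set.mem_iInter.2 fun n => ⟨iter α (-n) g, hVU (htV fun i hi => ?_), ?_⟩
    · rw [code_iter, hg]
      refine hδt ?_ i hi
      rw [Real.dist_0_eq_abs]
      exact (hsmall _).trans_le (min_le_left _ _)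
    · rw [iter, iter, ← Equiv.Perm.mul_apply, ← zpow_add, add_neg_cancel, zpow_zero]
      rfl
  rw [hUexp, Set.mem_singleton_iff] at hmem
  rw [hmem, map_zero] at hg
  ext n
  obtain ⟨k, hk⟩ := coe_unitAddCircle_eq_zero_iff.1 (congr_fun hg n).symm
  have h2 := (hsmall n).trans_le (min_le_right _ _)
  rw [← hk] at h2 ⊢
  have h3 : |k| < 1 := by exact_mod_cast h2
  simp [Int.abs_lt_one_iff.1 h3]

theorem eq_zero_of_bounded (hexp : IsExpansive α)
    (hχ : ∀ ψ : Dual α, ∃ p : ℤ[T;T⁻¹], ψ = p • χ) {f : ℤ[X]}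
    (hf : Module.annihilator ℤ[T;T⁻¹] (Dual α) = Ideal.span {toLaurent f}) {u : ℤ → ℝ}
    (hu : recurrence (· + 1) f u = 0) {C : ℝ} (hC : ∀ n, |u n| ≤ C) : u = 0 := by
  obtain ⟨δ, hδ, h⟩ := exists_pos_forall_solution_eq_zero hexp hχ hf
  have hC0 : 0 ≤ C := (abs_nonneg _).trans (hC 0)
  -- The multiple `t * u` is within the bound `δ`.
  set t := δ / (C + 1) with ht
  have ht0 : 0 < t := by positivity
  have h1 := h (fun n => t * u n) (by
    ext n
    rw [recurrence_const_mul, hu, Pi.zero_apply, mul_zero]) fun n => by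
      rw [abs_mul, abs_of_pos ht0]
      calc t * |u n| ≤ t * C := by gcongr; exact hC n
        _ < t * (C + 1) := by gcongr; linarith
        _ = δ := by rw [ht]; field_simp
  ext n
  exact (mul_eq_zero.1 (congr_fun h1 n)).resolve_left ht0.ne'

/-- A root `z` on the unit circle would yield the bounded solution `n ↦ Re (zⁿ)`. -/
theorem aeval_ne_zero_of_norm_eq_one (hexp : IsExpansive α)
    (hχ : ∀ ψ : Dual α, ∃ p : ℤ[T;T⁻¹], ψ = p • χ) {f : ℤ[X]}
    (hf : Module.annihilator ℤ[T;T⁻¹] (Dual α) = Ideal.span {toLaurent f}) {z : ℂ}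
    (hz : ‖z‖ = 1) : aeval z f ≠ 0 := by
  intro h0
  have hz0 : z ≠ 0 := norm_ne_zero_iff.1 (by rw [hz]; exact one_ne_zero)
  have h1 : recurrence (· + 1) f (fun n : ℤ => z ^ n) = 0 := by
    ext n
    rw [recurrence_int_apply]
    have h2 : ∀ i : ℕ, f.coeff i • z ^ (n + i : ℤ) = z ^ n * (f.coeff i • z ^ i) := fun i => by
      rw [zpow_add₀ hz0, zpow_natCast]
      simp only [zsmul_eq_mul]
      ring
    simp_rw [h2]
    rw [← Finset.mul_sum, ← aeval_eq_sum_range, h0, mul_zero]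
    rfl
  have h2 := recurrence_map Complex.reAddGroupHom (· + 1) f (fun n : ℤ => z ^ n)
  rw [h1] at h2
  have h3 := eq_zero_of_bounded hexp hχ hf (u := fun n => (z ^ n).re) (C := 1)
    (h2.trans (funext fun n => Complex.zero_re)) fun n =>
      (Complex.abs_re_le_norm _).trans (by rw [norm_zpow, hz, one_zpow])
  simpa using congr_fun h3 0

/-- A real solution `u` yields the path `t ↦ t u mod 1`. -/
theorem mem_pathComponent_of_real_solution
    (hχ : ∀ ψ : Dual α, ∃ p : ℤ[T;T⁻¹], ψ = p • χ) {f : ℤ[X]}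
    (hf : Module.annihilator ℤ[T;T⁻¹] (Dual α) = Ideal.span {toLaurent f}) {g : Γ} {u : ℤ → ℝ}
    (hu : recurrence (· + 1) f u = 0) (hg : ∀ n, (u n : UnitAddCircle) = χ.code g n) :
    g ∈ pathComponent (0 : Γ) := by
  have h1 : ∀ t : unitInterval, ∃ h : Γ, χ.code h = fun n => ((t * u n : ℝ) : UnitAddCircle) :=
    fun t => exists_code_eq hχ hf <| by
      rw [recurrence_coe]
      ext n
      rw [recurrence_const_mul, hu, Pi.zero_apply, mul_zero]
      rfl
  choose c hc using h1
  have hemb := isClosedEmbedding_code hχ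
  refine ⟨⟨⟨c, ?_⟩, hemb.injective ?_, hemb.injective ?_⟩⟩
  · rw [hemb.isEmbedding.continuous_iff, continuous_pi_iff]
    intro n
    have : (fun t => (χ.code ∘ c) t n) = fun t : unitInterval => ((t * u n : ℝ) : UnitAddCircle) :=
      funext fun t => congr_fun (hc t) n
    rw [this]
    exact (AddCircle.continuous_mk' (1 : ℝ)).comp (by fun_prop)
  · rw [hc, map_zero]
    ext n
    simp
  · rw [hc]
    ext n
    simp [hg]

/-- If an extreme coefficient of `f` is a unit, the defect `f(S) x` of a small real lift of a
homoclinic point is corrected by an integer sequence. -/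
theorem homoclinicGroup_subset_pathComponent (hχ : ∀ ψ : Dual α, ∃ p : ℤ[T;T⁻¹], ψ = p • χ)
    {f : ℤ[X]} (hf : Module.annihilator ℤ[T;T⁻¹] (Dual α) = Ideal.span {toLaurent f})
    (hunit : IsUnit f.leadingCoeff ∨ IsUnit (f.coeff 0)) :
    homoclinicGroup α ⊆ pathComponent (0 : Γ) := by
  intro g hg
  obtain ⟨x, hx, hxg⟩ := exists_real_lift_tendsto ((mem_homoclinicGroup_iff hχ g).1 hg)
  obtain ⟨h, hh⟩ := exists_intCast_eq_of_coe_eq_zero (u := recurrence (· + 1) f x) <| by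
    have h1 := recurrence_coe (· + 1) f x
    simp only [hxg] at h1
    rw [show (fun n => χ.code g n) = χ.code g from rfl, recurrence_code_eq_zero hf] at h1
    exact fun n => (congr_fun h1 n).symm
  have hfin : h.support.Finite := finite_support_of_tendsto <| by
    simpa only [hh] using tendsto_recurrence_cofinite f hx
  obtain ⟨v, hv⟩ : ∃ v : ℤ → ℤ, recurrence (· + 1) f v = h := hunit.elim
    (fun hu => exists_recurrence_eq_of_isUnit_leadingCoeff hu hfin)
    (fun hu => exists_recurrence_eq_of_isUnit_coeff_zero hu hfin)
  refine mem_pathComponent_of_real_solution hχ hf (u := fun n => x n - v n) ?_ fun n => ?_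
  · rw [recurrence_sub, recurrence_intCast, hv]
    ext n
    simp [hh]
  · rw [AddCircle.coe_sub, coe_unitAddCircle_eq_zero_iff.2 ⟨v n, rfl⟩, sub_zero, hxg]

/-- The fundamental homoclinic point: the reduction modulo `1` of the solution of
`f(S) y = δ` that tends to zero. -/
theorem exists_homoclinic_ne_zero (hexp : IsExpansive α)
    (hχ : ∀ ψ : Dual α, ∃ p : ℤ[T;T⁻¹], ψ = p • χ) {f : ℤ[X]}
    (hf : Module.annihilator ℤ[T;T⁻¹] (Dual α) = Ideal.span {toLaurent f}) (h0 : f.coeff 0 ≠ 0)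
    (hd : f.natDegree ≠ 0) : ∃ g ∈ homoclinicGroup α, g ≠ 0 := by
  obtain ⟨y, hy, hyf⟩ := exists_recurrence_eq_single (f := f)
    fun z hz => aeval_ne_zero_of_norm_eq_one hexp hχ hf hz
  obtain ⟨g, hg⟩ := exists_code_eq hχ hf (z := fun n => (y n : UnitAddCircle)) <| by
    rw [recurrence_coe, hyf]
    refine funext fun n => coe_unitAddCircle_eq_zero_iff.2 ⟨(Pi.single 0 1 : ℤ → ℤ) n, ?_⟩
    by_cases hn : n = 0
    · subst hn; simp
    · simp [hn]
  refine ⟨g, (mem_homoclinicGroup_iff hχ g).2 ?_, ?_⟩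
  · rw [hg]
    exact ((AddCircle.continuous_mk' (1 : ℝ)).tendsto' 0 0 rfl).comp hy
  · rintro rfl
    rw [map_zero] at hg
    obtain ⟨v, hv⟩ := exists_intCast_eq_of_coe_eq_zero fun n => (congr_fun hg n).symm
    have hfin : v.support.Finite := finite_support_of_tendsto (by simpa only [hv] using hy)
    refine recurrence_ne_single h0 hd (hfin.subset fun n hn => ?_) hyf
    rw [Function.mem_support, ← hv n] at hn
    exact_mod_cast hn

/-- A homoclinic point in the path component of `0` has a lift `x` tending to zero and a lift `u`
with `f(S) u = 0`. Their difference is an integer sequence, which has finite support if neither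
extreme coefficient of `f` is a unit; then `u` is bounded, hence zero by expansiveness, and so is
the point. -/
theorem isUnit_of_homoclinic_mem_pathComponent (hexp : IsExpansive α)
    (hχ : ∀ ψ : Dual α, ∃ p : ℤ[T;T⁻¹], ψ = p • χ) {f : ℤ[X]}
    (hf : Module.annihilator ℤ[T;T⁻¹] (Dual α) = Ideal.span {toLaurent f}) (h0 : f.coeff 0 ≠ 0)
    (hirr : Irreducible f) (hprim : f.IsPrimitive) {g : Γ} (hg : g ∈ homoclinicGroup α)
    (hgp : g ∈ pathComponent (0 : Γ)) (hg0 : g ≠ 0) :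
    IsUnit f.leadingCoeff ∨ IsUnit (f.coeff 0) := by
  by_contra! hnot
  obtain ⟨x, hx, hxg⟩ := exists_real_lift_tendsto ((mem_homoclinicGroup_iff hχ g).1 hg)
  obtain ⟨u, hu, hug⟩ := exists_real_solution_of_mem_pathComponent (χ := χ) hf hgp
  obtain ⟨v, hv⟩ := exists_intCast_eq_of_coe_eq_zero (u := fun n => x n - u n) fun n => by
    rw [AddCircle.coe_sub, hxg, hug, sub_self]
  have hrec : (recurrence (· + 1) f v).support.Finite := finite_support_of_tendsto <| by
    rw [← recurrence_intCast]
    simp_rw [hv]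
    rw [recurrence_sub, hu, sub_zero]
    exact tendsto_recurrence_cofinite f hx
  have hfin := finite_support_of_recurrence hirr hprim h0 hnot.1 hnot.2 hrec
  have hux : u =ᶠ[cofinite] x := by
    refine hfin.subset fun n hn hvn => hn ?_
    have := hv n
    rw [hvn, Int.cast_zero] at this
    change u n = x n
    linarith
  obtain ⟨C, hC⟩ := exists_bound_of_tendsto (hx.congr' hux.symm)
  have hu0 := eq_zero_of_bounded hexp hχ hf hu hC
  apply hg0
  apply code_injective hχ
  ext n
  rw [← hug, hu0, map_zero]
  rfl

end AlgDyn

theorem mainTheorem4 {Γ : Type*} [AddCommGroup Γ] [TopologicalSpace Γ] [IsTopologicalAddGroup Γ]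
    [CompactSpace Γ] [T2Space Γ] [ConnectedSpace Γ] (α : Γ ≃ₜ+ Γ)
    (hexp : AlgDyn.IsExpansive α) (hcyc : AlgDyn.IsCyclicSystem α)
    (f : ℤ[X]) (hf : AlgDyn.IsAssociatedPolynomial α f) (hirr : Irreducible f) :
    List.TFAE
      [AlgDyn.homoclinicGroup α ∩ pathComponent (0 : Γ) ≠ {0},
       AlgDyn.homoclinicGroup α ⊆ pathComponent (0 : Γ),
       AlgDyn.IsMonicUpToSign (toLaurent f) ∨
         AlgDyn.IsMonicUpToSign (LaurentPolynomial.invert (toLaurent f))] := by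
  obtain ⟨⟨χ, hχ⟩⟩ := hcyc
  replace hχ : ∀ ψ : AlgDyn.Dual α, ∃ p : ℤ[T;T⁻¹], ψ = p • χ := fun ψ => by
    have h : ψ ∈ Submodule.span ℤ[T;T⁻¹] {χ} := hχ ▸ Submodule.mem_top
    obtain ⟨p, hp⟩ := Submodule.mem_span_singleton.1 h
    exact ⟨p, hp.symm⟩
  have hann := hf.annihilator_eq
  have hdeg := natDegree_ne_zero_of_isPrimitive hirr hf.isPrimitive
  rw [isMonicUpToSign_toLaurent_iff, isMonicUpToSign_invert_toLaurent_iff hf.coeff_zero_ne_zero]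
  tfae_have 3 → 2 := AlgDyn.homoclinicGroup_subset_pathComponent hχ hann
  tfae_have 2 → 1 := fun h h1 => by
    obtain ⟨g, hg, hg0⟩ :=
      AlgDyn.exists_homoclinic_ne_zero hexp hχ hann hf.coeff_zero_ne_zero hdeg
    rw [Set.inter_eq_left.2 h] at h1
    exact hg0 (h1 ▸ hg : g ∈ ({0} : Set Γ))
  tfae_have 1 → 3 := fun h => by
    have h0 : (0 : Γ) ∈ AlgDyn.homoclinicGroup α ∩ pathComponent (0 : Γ) := by
      refine ⟨(AlgDyn.mem_homoclinicGroup_iff hχ 0).2 ?_, mem_pathComponent_self 0⟩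
      rw [map_zero]
      exact tendsto_const_nhds
    obtain ⟨g, hg, hg0⟩ : ∃ g ∈ AlgDyn.homoclinicGroup α ∩ pathComponent (0 : Γ), g ≠ 0 := by
      by_contra! hall
      exact h (Set.Subset.antisymm (fun g hg => hall g hg) (Set.singleton_subset_iff.2 h0))
    exact AlgDyn.isUnit_of_homoclinic_mem_pathComponent hexp hχ hann hf.coeff_zero_ne_zero hirr
      hf.isPrimitive hg.1 hg.2 hg0
  tfae_finish
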